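/- **Setting.** Let $d\in\{2,3\}$ and let $\Omega\subset\mathbb R^d$ be a bounded connected domain with disjoint open subsets $\Omega_c$ (conduit) and $\Omega_m$ (porous matrix), $\overline\Omega=\overline\Omega_c\cup\overline\Omega_m$, both with Lipschitz boundary. Put $\Gamma_{cm}=\partial\Omega_c\cap\partial\Omega_m$, $\Gamma_c=\partial\Omega_c\setminus\Gamma_{cm}$, $\Gamma_m=\partial\Omega_m\setminus\Gamma_{cm}$; let $\mathbf n_{cm}$ be the unit normal on $\Gamma_{cm}$ pointing from $\Omega_c$ to $\Omega_m$ and $\boldsymbol\tau_1,\dots,\boldsymbol\tau_{d-1}$ an orthonormal basis of the tangent space. Let $\rho_0,\chi,\gamma,\epsilon>0$ and $\alpha_{BJSJ}\ge 0$ be constants, let $\nu,M:\mathbb R\to\mathbb R$ satisfy $0<c\le\nu,M\le C$, and let the permeability $\Pi$ be a symmetric, bounded, uniformly positive definite matrix field on $\overline\Omega_m$. Write $(\cdot,\cdot)_c,(\cdot,\cdot)_m,(\cdot,\cdot)$ for the $L^2$ inner products on $\Omega_c,\Omega_m,\Omega$, $\mathbb D(\mathbf u)=\frac12(\nabla\mathbf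 u+\nabla^T\mathbf u)$, $f(\phi,\varphi)=\phi^3-\varphi$, $F(\varphi)=\frac14(\varphi^2-1)^2$. The closures $\overline\Omega_c,\overline\Omega_m$ carry finite meshes $\mathcal T_c^h,\mathcal T_m^h$ (for instance triangulations), and $\mathcal T^h=\mathcal T_c^h\cup\mathcal T_m^h$ is the mesh of $\overline\Omega$. The following finite-dimensional spaces are given. $Y_h\subset C(\overline\Omega)$ contains the constants; $\mathbf X_c^h\subset C(\overline\Omega_c)^d$ consists of fields that vanish on $\Gamma_c$; $M_m^h\subset C(\overline\Omega_m)$ consists of functions of mean zero; the functions in these three spaces are, on each cell of the respective mesh, $C^1$ up to the boundary of the cell (e.g. polynomials). $M_c^h\subset L^2(\Omega_c)$, and $\mathbf X_m^h\subset\{\mathbf w\in L^2(\Omega_m)^d:\nabla\cdot\mathbf w\in L^2(\Omega_m),\ \mathbf w\cdot\mathbf n=0\text{ on }\Gamma_m\}$. For some constant $c>0$, $$\sup_{\mathbf v\in\mathbf X_c^h}\frac{(\nabla\cdot\mathbf v,q)_c}{\|\mathbf v\|_{H^1}}\ge c\|q\|_{L^2}\ \ (q\in M_c^h),\qquad \sup_{\mathbf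 v\in\mathbf X_m^h}\frac{(\mathbf v,\nabla q)_m}{\|\mathbf v\|_{L^2}}\ge c\|q\|_{L^2}\ \ (q\in M_m^h).$$ **Scheme (PD).** Let $\tau>0$. Given $\varphi^k\in Y_h$, $\mathbf u_c^k\in\mathbf X_c^h$, $\mathbf u_m^k\in\mathbf X_m^h$, find $\varphi^{k+1},\mu^{k+1}\in Y_h$, $\mathbf u_c^{k+1}\in\mathbf X_c^h$, $P_c^{k+1}\in M_c^h$, $\mathbf u_m^{k+1}\in\mathbf X_m^h$, $P_m^{k+1}\in M_m^h$ such that for all $v,\phi\in Y_h$, $\mathbf v_c\in\mathbf X_c^h$, $q_c\in M_c^h$, $\mathbf v_m\in\mathbf X_m^h$, $q_m\in M_m^h$: $$\Big(\tfrac{\varphi^{k+1}-\varphi^k}{\tau},v\Big)+(M(\varphi^k)\nabla\mu^{k+1},\nabla v)-(\overline{\mathbf u}^{k+1}\varphi^k,\nabla v)=0,$$ $$\gamma\Big[\tfrac1\epsilon(f(\varphi^{k+1},\varphi^k),\phi)+\epsilon(\nabla\varphi^{k+1},\nabla\phi)\Big]-(\mu^{k+1},\phi)=0,$$ where the intermediate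 velocity $\overline{\mathbf u}^{k+1}$ is defined by $\frac{\rho_0}{\chi}\frac{\overline{\mathbf u}^{k+1}-\mathbf u_m^k}{\tau}+\varphi^k\nabla\mu^{k+1}=0$ in $\Omega_m$ and $\rho_0\frac{\overline{\mathbf u}^{k+1}-\mathbf u_c^k}{\tau}+\varphi^k\nabla\mu^{k+1}=0$ in $\Omega_c$; and $$\rho_0\Big(\tfrac{\mathbf u_c^{k+1}-\mathbf u_c^k}{\tau},\mathbf v_c\Big)_c+a_c(\mathbf u_c^{k+1},\mathbf v_c)+b_c(\mathbf v_c,P_c^{k+1})+\int_{\Gamma_{cm}}P_m^{k+1}\,\mathbf v_c\cdot\mathbf n_{cm}\,dS-b_c(\mathbf u_c^{k+1},q_c)+(\varphi^k\nabla\mu^{k+1},\mathbf v_c)_c=0,$$ $$\tfrac{\rho_0}{\chi}\Big(\tfrac{\mathbf u_m^{k+1}-\mathbf u_m^k}{\tau},\mathbf v_m\Big)_m+a_m(\mathbf u_m^{k+1},\mathbf v_m)+b_m(\mathbf v_m,P_m^{k+1})+(\varphi^k\nabla\mu^{k+1},\mathbf v_m)_m-\int_{\Gamma_{cm}}\mathbf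 u_c^{k+1}\cdot\mathbf n_{cm}\,q_m\,dS-b_m(\mathbf u_m^{k+1},q_m)=0,$$ with $b_c(\mathbf v,q)=-(\nabla\cdot\mathbf v,q)_c$, $b_m(\mathbf v,q)=(\mathbf v,\nabla q)_m$, $a_m(\mathbf u,\mathbf v)=(\nu(\varphi^k)\Pi^{-1}\mathbf u,\mathbf v)_m$ and $$a_c(\mathbf u,\mathbf v)=2(\nu(\varphi^k)\mathbb D(\mathbf u),\mathbb D(\mathbf v))_c+\sum_{i=1}^{d-1}\alpha_{BJSJ}\int_{\Gamma_{cm}}\frac{\nu(\varphi^k)}{\sqrt{\operatorname{trace}\Pi}}(\mathbf u\cdot\boldsymbol\tau_i)(\mathbf v\cdot\boldsymbol\tau_i)\,dS.$$ The discrete total energy is $$\mathcal E^k=\int_{\Omega_c}\frac{\rho_0}{2}|\mathbf u_c^k|^2dx+\int_{\Omega_m}\frac{\rho_0}{2\chi}|\mathbf u_m^k|^2dx+\gamma\int_\Omega\Big(\frac1\epsilon F(\varphi^k)+\frac\epsilon2|\nabla\varphi^k|^2\Big)dx.$$ **Theorem 1.** For every $\tau>0$ and all $\varphi^k\in Y_h$,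 $\mathbf u_c^k\in\mathbf X_c^h$, $\mathbf u_m^k\in\mathbf X_m^h$, the scheme (PD) has a unique solution $(\varphi^{k+1},\mu^{k+1},\mathbf u_c^{k+1},P_c^{k+1},\mathbf u_m^{k+1},P_m^{k+1})$. It conserves mass, $\int_\Omega\varphi^{k+1}dx=\int_\Omega\varphi^k dx$, and it satisfies the modified energy law $$\mathcal E^{k+1}-\mathcal E^k+\tau a_c(\mathbf u_c^{k+1},\mathbf u_c^{k+1})+\tau\|\sqrt{\nu/\Pi}\,\mathbf u_m^{k+1}\|_{L^2}^2\le-\frac{\gamma\epsilon}{2}\|\nabla(\varphi^{k+1}-\varphi^k)\|_{L^2}^2-\frac{\rho_0}{4}\|\mathbf u_c^{k+1}-\mathbf u_c^k\|_{L^2}^2-\frac{\rho_0}{4\chi}\|\mathbf u_m^{k+1}-\mathbf u_m^k\|_{L^2}^2,$$ where $\|\sqrt{\nu/\Pi}\,\mathbf u\|_{L^2}^2=(\nu(\varphi^k)\Pi^{-1}\mathbf u,\mathbf u)_m$. In particular $\mathcal E^{k+1}\le\mathcal E^k$ for every $\tau>0$: the scheme is unconditionally energy stable. -/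

import Mathlib

open MeasureTheory Set Filter Topology
open scoped RealInnerProductSpace Gradient Matrix NNReal ENNReal ContDiff

noncomputable section

namespace CHSD

/-! ## Geometry -/

/-- Euclidean space of dimension `d`. -/
abbrev Vec (d : ℕ) : Type := EuclideanSpace ℝ (Fin d)

/-- The Hilbert space `L²(D; F)` of classes of square integrable functions on `D`. -/
abbrev L2 {d : ℕ} (F : Type) [NormedAddCommGroup F] (D : Set (Vec d)) : Type :=
  Lp F 2 ((volume : Measure (Vec d)).restrict D)

/-- The boundary of `D` is Lipschitz continuous: near each boundary point, `D` is, for some unit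
direction `e`, the strict subgraph in direction `e` of a Lipschitz function of the component
orthogonal to `e`. -/
def HasLipschitzBoundary {d : ℕ} (D : Set (Vec d)) : Prop :=
  ∀ x ∈ frontier D, ∃ (e : Vec d) (g : Vec d → ℝ) (L : ℝ≥0), ‖e‖ = 1 ∧ LipschitzWith L g ∧
    ∀ᶠ y in 𝓝 x, (y ∈ D ↔ ⟪y, e⟫ < g (y - ⟪y, e⟫ • e))

/-- `n` is the unit outer normal of `D` at `x`: the half space `⟪y - x, n⟫ < 0` is tangent to `D`
at `x`. -/
def IsOuterNormal {d : ℕ} (D : Set (Vec d)) (n x : Vec d) : Prop :=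
  ‖n‖ = 1 ∧ ∀ δ > 0, ∀ᶠ y in 𝓝 x,
    (⟪y - x, n⟫ < -(δ * ‖y - x‖) → y ∈ D) ∧ (δ * ‖y - x‖ < ⟪y - x, n⟫ → y ∉ D)

/-- A bounded connected domain `Ω`, split into the conduit `Ωc` and the porous matrix `Ωm`, both
with Lipschitz boundary. -/
structure KarstDomain (d : ℕ) where
  Ω : Set (Vec d)
  Ωc : Set (Vec d)
  Ωm : Set (Vec d)
  isOpen_Ω : IsOpen Ω
  isConnected_Ω : IsConnected Ω
  isBounded_Ω : Bornology.IsBounded Ω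
  isOpen_Ωc : IsOpen Ωc
  isOpen_Ωm : IsOpen Ωm
  Ωc_subset : Ωc ⊆ Ω
  Ωm_subset : Ωm ⊆ Ω
  disjoint : Disjoint Ωc Ωm
  closure_eq : closure Ω = closure Ωc ∪ closure Ωm
  lipschitz_c : HasLipschitzBoundary Ωc
  lipschitz_m : HasLipschitzBoundary Ωm

namespace KarstDomain

variable {d : ℕ} (G : KarstDomain d)

/-- The interface between conduit and matrix. -/
def Γcm : Set (Vec d) := frontier G.Ωc ∩ frontier G.Ωm

/-- The outer boundary of the conduit. -/
def Γc : Set (Vec d) := frontier G.Ωc \ G.Γcm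

/-- The surface measure on the interface. -/
def dS : Measure (Vec d) := (μHE[d - 1]).restrict G.Γcm

end KarstDomain

/-- The unit normal on the interface pointing from the conduit to the matrix, and an orthonormal
basis of the tangent space to the interface (almost everywhere on the interface). -/
structure InterfaceFrame {d : ℕ} (G : KarstDomain d) where
  n : Vec d → Vec d
  t : Fin (d - 1) → Vec d → Vec d
  measurable_n : Measurable n
  measurable_t : ∀ i, Measurable (t i)
  isOuterNormal : ∀ᵐ x ∂G.dS, IsOuterNormal G.Ωc (n x) x
  orthonormal_t : ∀ᵐ x ∂G.dS, Orthonormal ℝ (fun i => t i x)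
  inner_t_n : ∀ᵐ x ∂G.dS, ∀ i, ⟪t i x, n x⟫ = 0

/-! ## Physical parameters -/

/-- The parameters: density `ρ₀`, porosity `χ`, surface tension parameter `γ`, interface width `ε`,
interface friction coefficient `α`, viscosity `ν` and mobility `M` as functions of the phase
variable, permeability matrix `perm` (depending on the position in the porous matrix). -/
structure Params {d : ℕ} (G : KarstDomain d) where
  ρ₀ : ℝ
  χ : ℝ
  γ : ℝ
  ε : ℝ
  α : ℝ
  ν : ℝ → ℝ
  M : ℝ → ℝ
  perm : Vec d → Matrix (Fin d) (Fin d) ℝ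
  ρ₀_pos : 0 < ρ₀
  χ_pos : 0 < χ
  γ_pos : 0 < γ
  ε_pos : 0 < ε
  α_nonneg : 0 ≤ α
  measurable_ν : Measurable ν
  measurable_M : Measurable M
  bounds : ∃ c C : ℝ, 0 < c ∧ ∀ s, c ≤ ν s ∧ ν s ≤ C ∧ c ≤ M s ∧ M s ≤ C
  measurable_perm : ∀ i j, Measurable fun x => perm x i j
  symm_perm : ∀ x ∈ closure G.Ωm, (perm x).IsSymm
  bounds_perm : ∃ c C : ℝ, 0 < c ∧ ∀ x ∈ closure G.Ωm, ∀ ξ : Fin d → ℝ,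
    c * (ξ ⬝ᵥ ξ) ≤ ξ ⬝ᵥ (perm x *ᵥ ξ) ∧ ξ ⬝ᵥ (perm x *ᵥ ξ) ≤ C * (ξ ⬝ᵥ ξ)

/-! ## Differential operators -/

variable {d : ℕ}

/-- The Jacobian matrix `∂ⱼ uᵢ`. -/
def jac (u : Vec d → Vec d) (x : Vec d) : Matrix (Fin d) (Fin d) ℝ :=
  Matrix.of fun i j => fderiv ℝ u x (EuclideanSpace.single j 1) i

/-- The divergence. -/
def dvg (u : Vec d → Vec d) (x : Vec d) : ℝ := (jac u x).trace

/-- The rate of strain tensor `½ (∇u + ∇uᵀ)`. -/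
def strain (u : Vec d → Vec d) (x : Vec d) : Matrix (Fin d) (Fin d) ℝ :=
  (1 / 2 : ℝ) • (jac u x + (jac u x)ᵀ)

/-- The Frobenius product `A : B`. -/
def frob (A B : Matrix (Fin d) (Fin d) ℝ) : ℝ := ∑ i, ∑ j, A i j * B i j

/-- The norm of `H¹(D)^d`. -/
def normH1 (D : Set (Vec d)) (v : Vec d → Vec d) : ℝ :=
  Real.sqrt (∫ x in D, (‖v x‖ ^ 2 + frob (jac v x) (jac v x)))

/-! ## Finite element spaces -/

/-- A finite decomposition of the closure of `D` into closed cells with disjoint interiors.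
Triangulations (with straight or curved simplices) are the main example; no condition on the shape
of the cells or on the way neighbouring cells meet is needed. -/
structure IsMesh (T : Set (Set (Vec d))) (D : Set (Vec d)) : Prop where
  finite : T.Finite
  isCompact : ∀ K ∈ T, IsCompact K
  regular : ∀ K ∈ T, (interior K).Nonempty ∧ closure (interior K) = K
  null_frontier : ∀ K ∈ T, volume (frontier K) = 0
  disjoint : T.PairwiseDisjoint interior
  cover : ⋃₀ T = closure D

/-- `w` is an `H¹`-conforming finite element function on `D` for the mesh `T`: it is continuous on
the closure of `D`, and its restriction to each cell is `C¹` up to the boundary of the cell (for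
instance a polynomial). Functions on the closure of `D` are represented by their extension by zero,
so that equality of two such functions is equality on the closure of `D`. In the open set `D` the
gradient of `w` is, almost everywhere, the classical one. -/
structure IsConforming {F : Type} [NormedAddCommGroup F] [NormedSpace ℝ F]
    (T : Set (Set (Vec d))) (D : Set (Vec d)) (w : Vec d → F) : Prop where
  continuousOn : ContinuousOn w (closure D)
  piecewise : ∀ K ∈ T, ∃ g : Vec d → F, ContDiff ℝ 1 g ∧ EqOn w g K
  eq_zero : ∀ x ∉ closure D, w x = 0

/-- The space `H_{m,0}`: fields `w ∈ L²(Ωm)^d` with divergence `g ∈ L²(Ωm)` and with vanishing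
normal component on the part of the boundary of `Ωm` outside the interface. Both conditions are
expressed by Green's formula for test functions that vanish near the interface. -/
def MemHm0 (G : KarstDomain d) (w : L2 (Vec d) G.Ωm) : Prop :=
  ∃ g : L2 ℝ G.Ωm, ∀ ψ : Vec d → ℝ, ContDiff ℝ ∞ ψ → HasCompactSupport ψ →
    Disjoint (tsupport ψ) G.Γcm →
    ∫ x in G.Ωm, ⟪w x, ∇ ψ x⟫ = -∫ x in G.Ωm, g x * ψ x

/-- The finite element spaces: `Y` (phase variable and chemical potential), `Xc`, `Mc` (conduit
velocity and pressure), `Xm`, `Mm` (matrix velocity and pressure), with the two inf-sup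
conditions. -/
structure FESpaces (G : KarstDomain d) where
  Tc : Set (Set (Vec d))
  Tm : Set (Set (Vec d))
  isMesh_c : IsMesh Tc G.Ωc
  isMesh_m : IsMesh Tm G.Ωm
  Y : Submodule ℝ (Vec d → ℝ)
  Xc : Submodule ℝ (Vec d → Vec d)
  Mc : Submodule ℝ (L2 ℝ G.Ωc)
  Xm : Submodule ℝ (L2 (Vec d) G.Ωm)
  Mm : Submodule ℝ (Vec d → ℝ)
  finite_Y : FiniteDimensional ℝ Y
  finite_Xc : FiniteDimensional ℝ Xc
  finite_Mc : FiniteDimensional ℝ Mc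
  finite_Xm : FiniteDimensional ℝ Xm
  finite_Mm : FiniteDimensional ℝ Mm
  conforming_Y : ∀ w ∈ Y, IsConforming (Tc ∪ Tm) G.Ω w
  /-- the constants belong to `Y` -/
  one_mem_Y : (closure G.Ω).indicator (fun _ => (1 : ℝ)) ∈ Y
  conforming_Xc : ∀ w ∈ Xc, IsConforming Tc G.Ωc w
  zero_Xc : ∀ w ∈ Xc, ∀ x ∈ G.Γc, w x = 0
  mem_Xm : ∀ w ∈ Xm, MemHm0 G w
  conforming_Mm : ∀ q ∈ Mm, IsConforming Tm G.Ωm q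
  mean_Mm : ∀ q ∈ Mm, ∫ x in G.Ωm, q x = 0
  infsup_c : ∃ c > 0, ∀ q ∈ Mc,
    c * ‖q‖ ≤ ⨆ v : Xc, (∫ x in G.Ωc, dvg v.1 x * q x) / normH1 G.Ωc v.1
  infsup_m : ∃ c > 0, ∀ q ∈ Mm,
    c * Real.sqrt (∫ x in G.Ωm, q x ^ 2) ≤ ⨆ v : Xm, (∫ x in G.Ωm, ⟪v.1 x, ∇ q x⟫) / ‖v‖

/-! ## The scheme -/

/-- The discrete state `(φ_h^k, u_{c,h}^k, u_{m,h}^k)` at one time level. -/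
structure State {G : KarstDomain d} (S : FESpaces G) where
  φ : S.Y
  uc : S.Xc
  um : S.Xm

/-- The unknowns of one time step: the new state, the chemical potential and the pressures. -/
structure Unknowns {G : KarstDomain d} (S : FESpaces G) extends State S where
  μ : S.Y
  Pc : S.Mc
  Pm : S.Mm

section Forms

variable {G : KarstDomain d} (N : InterfaceFrame G) (P : Params G)

/-- The form `a_c`, for the phase variable `φ` at the old time level. -/
def ac (φ : Vec d → ℝ) (u v : Vec d → Vec d) : ℝ :=
  2 * (∫ x in G.Ωc, P.ν (φ x) * frob (strain u x) (strain v x)) +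
    ∑ i, P.α * ∫ x, P.ν (φ x) / Real.sqrt (P.perm x).trace * ⟪u x, N.t i x⟫ * ⟪v x, N.t i x⟫ ∂G.dS

/-- The form `b_c(v, q) = -(∇ · v, q)_c`. -/
def bc (G : KarstDomain d) (v : Vec d → Vec d) (q : L2 ℝ G.Ωc) : ℝ :=
  -∫ x in G.Ωc, dvg v x * q x

/-- The form `a_m(u, v) = (ν(φ) Π⁻¹ u, v)_m`; in particular `a_m(u, u) = ‖√(ν/Π) u‖²`. -/
def am (φ : Vec d → ℝ) (u v : L2 (Vec d) G.Ωm) : ℝ :=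
  ∫ x in G.Ωm, P.ν (φ x) * (((P.perm x)⁻¹ *ᵥ (u x).ofLp) ⬝ᵥ (v x).ofLp)

/-- The form `b_m(v, q) = (v, ∇q)_m`. -/
def bm (G : KarstDomain d) (v : L2 (Vec d) G.Ωm) (q : Vec d → ℝ) : ℝ :=
  ∫ x in G.Ωm, ⟪v x, ∇ q x⟫

/-- `∫_{Γcm} q (v · n_cm) dS`. -/
def flux (v : Vec d → Vec d) (q : Vec d → ℝ) : ℝ :=
  ∫ x, q x * ⟪v x, N.n x⟫ ∂G.dS

end Forms

section Scheme

variable {G : KarstDomain d} (N : InterfaceFrame G) (P : Params G) {S : FESpaces G}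

/-- The intermediate velocity, driven only by the capillary force. -/
def ubar (τ : ℝ) (s : State S) (μ : Vec d → ℝ) : Vec d → Vec d := fun x =>
  G.Ωm.indicator (fun x => s.um.1 x - (τ * P.χ / P.ρ₀ * s.φ.1 x) • ∇ μ x) x +
    G.Ωc.indicator (fun x => s.uc.1 x - (τ / P.ρ₀ * s.φ.1 x) • ∇ μ x) x

/-- The equation that defines the intermediate velocity in the porous matrix. -/
theorem ubar_m {τ : ℝ} (hτ : 0 < τ) (s : State S) (μ : Vec d → ℝ) {x : Vec d} (hx : x ∈ G.Ωm) :
    (P.ρ₀ / P.χ) • τ⁻¹ • (ubar P τ s μ x - s.um.1 x) + s.φ.1 x • ∇ μ x = 0 := by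
  have hx' : x ∉ G.Ωc := fun h => Set.disjoint_left.1 G.disjoint h hx
  have h1 := P.ρ₀_pos.ne'
  have h2 := P.χ_pos.ne'
  have h : P.ρ₀ / P.χ * (τ⁻¹ * (τ * P.χ / P.ρ₀ * s.φ.1 x)) = s.φ.1 x := by
    field_simp
  simp only [ubar, indicator_of_mem hx, indicator_of_notMem hx', add_zero, sub_sub_cancel_left,
    smul_neg, smul_smul, h]
  exact neg_add_cancel _

/-- The equation that defines the intermediate velocity in the conduit. -/
theorem ubar_c {τ : ℝ} (hτ : 0 < τ) (s : State S) (μ : Vec d → ℝ) {x : Vec d} (hx : x ∈ G.Ωc) :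
    P.ρ₀ • τ⁻¹ • (ubar P τ s μ x - s.uc.1 x) + s.φ.1 x • ∇ μ x = 0 := by
  have hx' : x ∉ G.Ωm := fun h => Set.disjoint_left.1 G.disjoint hx h
  have h1 := P.ρ₀_pos.ne'
  have h : P.ρ₀ * (τ⁻¹ * (τ / P.ρ₀ * s.φ.1 x)) = s.φ.1 x := by
    field_simp
  simp only [ubar, indicator_of_mem hx, indicator_of_notMem hx', zero_add, sub_sub_cancel_left,
    smul_neg, smul_smul, h]
  exact neg_add_cancel _

/-- `z` solves one step of the partially decoupled scheme with time step `τ`, starting from the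
state `s`. -/
structure IsStep (τ : ℝ) (s : State S) (z : Unknowns S) : Prop where
  phase : ∀ v : S.Y,
    (∫ x in G.Ω, (z.φ.1 x - s.φ.1 x) / τ * v.1 x)
      + (∫ x in G.Ω, P.M (s.φ.1 x) * ⟪∇ z.μ.1 x, ∇ v.1 x⟫)
      - (∫ x in G.Ω, ⟪s.φ.1 x • ubar P τ s z.μ.1 x, ∇ v.1 x⟫) = 0
  potential : ∀ ϕ : S.Y,
    P.γ * (1 / P.ε * (∫ x in G.Ω, (z.φ.1 x ^ 3 - s.φ.1 x) * ϕ.1 x)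
        + P.ε * ∫ x in G.Ω, ⟪∇ z.φ.1 x, ∇ ϕ.1 x⟫)
      - (∫ x in G.Ω, z.μ.1 x * ϕ.1 x) = 0
  stokes : ∀ (v : S.Xc) (q : S.Mc),
    P.ρ₀ * (∫ x in G.Ωc, ⟪τ⁻¹ • (z.uc.1 x - s.uc.1 x), v.1 x⟫)
      + ac N P s.φ.1 z.uc.1 v.1 + bc G v.1 z.Pc.1 + flux N v.1 z.Pm.1 - bc G z.uc.1 q.1
      + (∫ x in G.Ωc, ⟪s.φ.1 x • ∇ z.μ.1 x, v.1 x⟫) = 0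
  darcy : ∀ (v : S.Xm) (q : S.Mm),
    P.ρ₀ / P.χ * (∫ x in G.Ωm, ⟪τ⁻¹ • (z.um.1 x - s.um.1 x), v.1 x⟫)
      + am P s.φ.1 z.um.1 v.1 + bm G v.1 z.Pm.1
      + (∫ x in G.Ωm, ⟪s.φ.1 x • ∇ z.μ.1 x, v.1 x⟫)
      - flux N z.uc.1 q.1 - bm G z.um.1 q.1 = 0

/-- The discrete total energy, with `F(φ) = ¼ (φ² - 1)²`. -/
def energy (s : State S) : ℝ :=
  (∫ x in G.Ωc, P.ρ₀ / 2 * ‖s.uc.1 x‖ ^ 2) + (∫ x in G.Ωm, P.ρ₀ / (2 * P.χ) * ‖s.um.1 x‖ ^ 2)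
    + P.γ * ∫ x in G.Ω,
      (1 / P.ε * (1 / 4 * (s.φ.1 x ^ 2 - 1) ^ 2) + P.ε / 2 * ‖∇ s.φ.1 x‖ ^ 2)

end Scheme

end CHSD

end

namespace CHSD

/-! ### Boundaries of Lipschitz domains -/

/-! The intermediate velocity is explicit in the old velocities and in the new chemical potential.
Substituting it in the phase equation (`phase_transport_eq`) leaves a Cahn–Hilliard problem for the
phase variable and the potential alone, whose symmetric mobility form gains the nonnegative terms
τ/ρ₀ ‖φᵏ∇μ‖² in the conduit and τχ/ρ₀ ‖φᵏ∇μ‖² in the matrix. Once μ is known, velocities and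
pressures solve a square linear system. `isStep_iff` records this decoupling.

The Cahn–Hilliard problem is an implicit gradient step for the convex energy `splitEnergy` in the
metric dual to the mobility form. A solution comes from a finite-dimensional minimization
(`exists_gradient_step`), uniqueness from the monotonicity of the cube (`eq_of_cubic_monotone`). The
linear flow system is injective, hence bijective: tested with its own solution it loses all pressure
and interface terms, so the velocities vanish, and the inf-sup conditions then remove the pressures
(`flowForm_injective`).

For the energy law, the phase equation is tested with μ, the potential equation with the increment
of φ, and the flow equations with the new velocities. Convex splitting controls the double well
(`doubleWell_sub_le`). The capillary force acts through the intermediate velocity in the phase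
equation but through the new velocity in the momentum equations; the mismatch is absorbed by the
extra mobility terms and by half of the numerical dissipation ρ/2 ‖u - u₀‖², which is why ρ/4
survives (`kinetic_energy_le`).

The analytic groundwork turns every integral into an `L²` inner product of linear maps. Lipschitz
boundaries provide a finite interface measure and a null boundary, so traces are square integrable
and integrals over Ω split into conduit and matrix. -/

theorem finrank_orthogonal_unit {d : ℕ} (hd : 1 ≤ d) {e : Vec d} (he : ‖e‖ = 1) :
    Module.finrank ℝ (ℝ ∙ e)ᗮ = d - 1 := by
  have he0 : e ≠ 0 := by
    rintro rfl
    simp at he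
  obtain ⟨n, rfl⟩ := Nat.exists_eq_add_of_le' hd
  have : Fact (Module.finrank ℝ (Vec (n + 1)) = n + 1) := ⟨by simp⟩
  simpa using Submodule.finrank_orthogonal_span_singleton (𝕜 := ℝ) (n := n) he0

/-- In the dimension of the space itself, Hausdorff measure is an additive Haar measure. -/
theorem hausdorff_lt_top_of_isBounded {E : Type*} [NormedAddCommGroup E] [InnerProductSpace ℝ E]
    [FiniteDimensional ℝ E] [MeasurableSpace E] [BorelSpace E] {n : ℕ}
    (hn : Module.finrank ℝ E = n) {B : Set E} (hB : Bornology.IsBounded B) :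
    (μH[(n : ℝ)] : Measure E) B < ⊤ := by
  subst hn
  have := isAddHaarMeasure_hausdorffMeasure (E := E)
  exact hB.measure_lt_top

/-- The boundary of an open Lipschitz set is locally contained in a Lipschitz graph, hence has
locally finite Hausdorff measure of codimension one. -/
theorem HasLipschitzBoundary.exists_nhds {d : ℕ} (hd : 1 ≤ d) {D : Set (Vec d)}
    (hD : HasLipschitzBoundary D) (hopen : IsOpen D) {x : Vec d} (hx : x ∈ frontier D) :
    ∃ U ∈ 𝓝 x, (μH[((d - 1 : ℕ) : ℝ)] : Measure (Vec d)) (U ∩ frontier D) < ⊤ := by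
  obtain ⟨e, g, L, he, hg, hev⟩ := hD x hx
  obtain ⟨U, hUs, hUo, hxU⟩ := eventually_nhds_iff.1 hev
  refine ⟨U ∩ Metric.ball x 1, inter_mem (hUo.mem_nhds hxU) (Metric.ball_mem_nhds x one_pos), ?_⟩
  have hcont : Continuous fun y : Vec d => g (y - ⟪y, e⟫ • e) :=
    hg.continuous.comp (by fun_prop)
  have hinn : Continuous fun y : Vec d => ⟪y, e⟫ := by fun_prop
  -- A frontier point is not strictly below the graph, as the open set `D` contains no frontier
  -- point; nor strictly above, as a whole neighbourhood there misses `D`.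
  have hgraph : ∀ y ∈ U ∩ frontier D, ⟪y, e⟫ = g (y - ⟪y, e⟫ • e) := by
    rintro y ⟨hyU, hyD⟩
    have hyn : y ∉ D := by
      rw [hopen.frontier_eq] at hyD
      exact hyD.2
    refine le_antisymm ?_ (not_lt.1 fun h => hyn ((hUs y hyU).2 h))
    by_contra! h
    have h1 : ∀ᶠ z in 𝓝 y, z ∉ D := by
      filter_upwards [hUo.mem_nhds hyU, (isOpen_lt hcont hinn).mem_nhds h] with z hz hz' hzD
      exact lt_asymm ((hUs z hz).1 hzD) hz'
    have h2 := mem_closure_iff_frequently.1 (frontier_subset_closure hyD)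
    exact h2 (h1.mono fun z hz => hz)
  set p : (ℝ ∙ e)ᗮ → Vec d := fun q => (q : Vec d) + g q • e with hp
  have hpL : LipschitzWith (1 + L) p := by
    refine LipschitzWith.of_dist_le_mul fun a b => ?_
    have h1 : dist (p a) (p b) ≤ dist (a : Vec d) b + dist (g a • e) (g b • e) :=
      dist_add_add_le _ _ _ _
    have h2 : dist (g a • e) (g b • e) = dist (g a) (g b) := by
      rw [dist_eq_norm, ← sub_smul, norm_smul, he, mul_one, Real.dist_eq, Real.norm_eq_abs]
    have h3 := hg.dist_le_mul (a : Vec d) b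
    have h4 : dist (a : Vec d) b = dist a b := rfl
    push_cast
    rw [h2] at h1
    rw [h4] at h1 h3
    linarith
  have hmem : ∀ y : Vec d, y - ⟪y, e⟫ • e ∈ (ℝ ∙ e)ᗮ := by
    intro y
    rw [Submodule.mem_orthogonal_singleton_iff_inner_left, inner_sub_left, real_inner_smul_left,
      real_inner_self_eq_norm_sq, he]
    ring
  -- Points of the unit ball about `x` have norm at most ‖x‖ + 1, and removing the component along
  -- `e` at most doubles this bound.
  have hsub : U ∩ Metric.ball x 1 ∩ frontier D ⊆
      p '' Metric.closedBall (0 : (ℝ ∙ e)ᗮ) (2 * (‖x‖ + 1)) := by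
    rintro y ⟨⟨hyU, hyB⟩, hyD⟩
    refine ⟨⟨y - ⟪y, e⟫ • e, hmem y⟩, ?_, ?_⟩
    · rw [mem_closedBall_zero_iff, Submodule.coe_norm]
      have h1 : ‖y‖ ≤ ‖x‖ + 1 := by
        have := norm_le_norm_add_norm_sub' y x
        have h2 := mem_ball_iff_norm.1 hyB
        linarith
      have h2 : ‖⟪y, e⟫ • e‖ ≤ ‖y‖ := by
        rw [norm_smul, he, mul_one]
        simpa [he] using norm_inner_le_norm (𝕜 := ℝ) y e
      have h3 := norm_sub_le y (⟪y, e⟫ • e)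
      linarith
    · simp only [hp]
      rw [← hgraph y ⟨hyU, hyD⟩]
      abel
  refine (measure_mono hsub).trans_lt ?_
  refine (hpL.hausdorffMeasure_image_le (Nat.cast_nonneg _) _).trans_lt ?_
  refine ENNReal.mul_lt_top (ENNReal.rpow_lt_top_of_nonneg (Nat.cast_nonneg _) ENNReal.coe_ne_top) ?_
  exact hausdorff_lt_top_of_isBounded (finrank_orthogonal_unit hd he) Metric.isBounded_closedBall

theorem HasLipschitzBoundary.hausdorff_frontier_lt_top {d : ℕ} (hd : 1 ≤ d) {D : Set (Vec d)}
    (hD : HasLipschitzBoundary D) (hopen : IsOpen D) (hb : Bornology.IsBounded D) :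
    (μH[((d - 1 : ℕ) : ℝ)] : Measure (Vec d)) (frontier D) < ⊤ := by
  have hc : IsCompact (frontier D) :=
    hb.isCompact_closure.of_isClosed_subset isClosed_frontier frontier_subset_closure
  refine hc.measure_lt_top_of_nhdsWithin fun x hx => ?_
  obtain ⟨U, hU, hfin⟩ := hD.exists_nhds hd hopen hx
  exact ⟨U ∩ frontier D, inter_comm U _ ▸ inter_mem_nhdsWithin _ hU, hfin⟩

/-- Finite Hausdorff measure in dimension d - 1 forces measure zero in dimension d, where Hausdorff
measure is a Haar measure. -/
theorem HasLipschitzBoundary.volume_frontier {d : ℕ} (hd : 1 ≤ d) {D : Set (Vec d)}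
    (hD : HasLipschitzBoundary D) (hopen : IsOpen D) (hb : Bornology.IsBounded D) :
    volume (frontier D) = 0 := by
  have h := hD.hausdorff_frontier_lt_top hd hopen hb
  have hlt : ((d - 1 : ℕ) : ℝ) < (d : ℝ) := by
    exact_mod_cast Nat.sub_lt hd one_pos
  have h0 := (Measure.hausdorffMeasure_zero_or_top hlt (frontier D)).resolve_right h.ne
  have : (μH[(d : ℝ)] : Measure (Vec d)).IsAddHaarMeasure := by
    simpa using isAddHaarMeasure_hausdorffMeasure (E := Vec d)
  exact Measure.absolutelyContinuous_isAddHaarMeasure volume (μH[(d : ℝ)] : Measure (Vec d)) h0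

/-! ### Interface measure and decomposition of the domain -/

namespace KarstDomain

variable {d : ℕ} (G : KarstDomain d)

theorem isBounded_Ωc : Bornology.IsBounded G.Ωc := G.isBounded_Ω.subset G.Ωc_subset

theorem isBounded_Ωm : Bornology.IsBounded G.Ωm := G.isBounded_Ω.subset G.Ωm_subset

theorem isFiniteMeasure_dS (hd : 1 ≤ d) : IsFiniteMeasure G.dS := by
  refine ⟨?_⟩
  have h := G.lipschitz_c.hausdorff_frontier_lt_top hd G.isOpen_Ωc G.isBounded_Ωc
  rw [dS, Measure.restrict_apply_univ, Measure.euclideanHausdorffMeasure_def]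
  rw [ENNReal.smul_def, Measure.smul_apply, smul_eq_mul]
  exact ENNReal.mul_lt_top ENNReal.coe_lt_top ((measure_mono inter_subset_left).trans_lt h)

theorem ae_dS_mem : ∀ᵐ x ∂G.dS, x ∈ G.Γcm := by
  have : MeasurableSet G.Γcm := (isClosed_frontier.inter isClosed_frontier).measurableSet
  exact ae_restrict_mem this

/-- The closures of the two subdomains cover Ω, so whatever the open subdomains miss lies on their
null frontiers. -/
theorem ae_Ω_mem (hd : 1 ≤ d) : ∀ᵐ x ∂(volume.restrict G.Ω), x ∈ G.Ωc ∪ G.Ωm := by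
  rw [ae_restrict_iff' G.isOpen_Ω.measurableSet]
  have hc := G.lipschitz_c.volume_frontier hd G.isOpen_Ωc G.isBounded_Ωc
  have hm := G.lipschitz_m.volume_frontier hd G.isOpen_Ωm G.isBounded_Ωm
  filter_upwards [measure_eq_zero_iff_ae_notMem.1 hc, measure_eq_zero_iff_ae_notMem.1 hm]
    with x h1 h2 hx
  have hx' : x ∈ closure G.Ωc ∪ closure G.Ωm := G.closure_eq ▸ subset_closure hx
  rw [G.isOpen_Ωc.frontier_eq] at h1
  rw [G.isOpen_Ωm.frontier_eq] at h2
  by_contra h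
  simp only [mem_union, not_or] at h
  rcases hx' with h' | h'
  · exact h1 ⟨h', h.1⟩
  · exact h2 ⟨h', h.2⟩

theorem setIntegral_Ω (hd : 1 ≤ d) {f : Vec d → ℝ} (hc : IntegrableOn f G.Ωc)
    (hm : IntegrableOn f G.Ωm) : ∫ x in G.Ω, f x = (∫ x in G.Ωc, f x) + ∫ x in G.Ωm, f x := by
  have h : (volume.restrict G.Ω : Measure (Vec d)) = volume.restrict (G.Ωc ∪ G.Ωm) := by
    refine Measure.restrict_congr_set ?_
    have h1 := (ae_restrict_iff' G.isOpen_Ω.measurableSet).1 (G.ae_Ω_mem hd)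
    filter_upwards [h1] with x hx
    exact propext ⟨hx, fun h => h.elim (fun h => G.Ωc_subset h) fun h => G.Ωm_subset h⟩
  rw [h]
  exact setIntegral_union G.disjoint G.isOpen_Ωm.measurableSet hc hm

end KarstDomain

/-! ### Piecewise smooth functions -/

/-- `T` covers the closure of `D` by finitely many compact cells with null boundaries. -/
structure IsCellCover {d : ℕ} (T : Set (Set (Vec d))) (D : Set (Vec d)) : Prop where
  finite : T.Finite
  isCompact : ∀ K ∈ T, IsCompact K
  null_frontier : ∀ K ∈ T, volume (frontier K) = 0
  cover : ⋃₀ T = closure D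

variable {d : ℕ}

theorem IsMesh.isCellCover {T : Set (Set (Vec d))} {D : Set (Vec d)} (h : IsMesh T D) :
    IsCellCover T D :=
  ⟨h.finite, h.isCompact, h.null_frontier, h.cover⟩

theorem FESpaces.isCellCover {G : KarstDomain d} (S : FESpaces G) :
    IsCellCover (S.Tc ∪ S.Tm) G.Ω where
  finite := S.isMesh_c.finite.union S.isMesh_m.finite
  isCompact K hK := hK.elim (S.isMesh_c.isCompact K) (S.isMesh_m.isCompact K)
  null_frontier K hK := hK.elim (S.isMesh_c.null_frontier K) (S.isMesh_m.null_frontier K)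
  cover := by rw [sUnion_union, S.isMesh_c.cover, S.isMesh_m.cover, G.closure_eq]

theorem IsCellCover.isCompact_closure {T : Set (Set (Vec d))} {D : Set (Vec d)}
    (h : IsCellCover T D) : IsCompact (closure D) := by
  rw [← h.cover]
  exact h.finite.isCompact_sUnion h.isCompact

/-- Finitely many null frontiers are discarded. Inside a cell a finite element function coincides
with a `C¹` function, so its classical derivative exists almost everywhere. -/
theorem IsCellCover.ae_mem_interior {T : Set (Set (Vec d))} {D : Set (Vec d)}
    (h : IsCellCover T D) : ∀ᵐ x : Vec d, x ∈ closure D → ∃ K ∈ T, x ∈ interior K := by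
  have h0 : ∀ᵐ x : Vec d, ∀ K ∈ T, x ∉ frontier K :=
    (ae_ball_iff h.finite.countable).2 fun K hK =>
      measure_eq_zero_iff_ae_notMem.1 (h.null_frontier K hK)
  filter_upwards [h0] with x hx hxD
  rw [← h.cover] at hxD
  obtain ⟨K, hK, hxK⟩ := hxD
  refine ⟨K, hK, ?_⟩
  by_contra hi
  exact hx K hK ⟨subset_closure hxK, hi⟩

section Conforming

variable {F : Type} [NormedAddCommGroup F] [NormedSpace ℝ F] {T : Set (Set (Vec d))}
  {D : Set (Vec d)} {w : Vec d → F}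

theorem IsConforming.measurable [MeasurableSpace F] [BorelSpace F] (hw : IsConforming T D w) :
    Measurable w := by
  have h : w = (closure D).indicator w := by
    ext1 x
    by_cases hx : x ∈ closure D
    · rw [indicator_of_mem hx]
    · rw [indicator_of_notMem hx, hw.eq_zero x hx]
  rw [h]
  classical
  rw [← piecewise_eq_indicator]
  exact hw.continuousOn.measurable_piecewise continuousOn_const isClosed_closure.measurableSet

theorem IsConforming.exists_bound (hT : IsCellCover T D) (hw : IsConforming T D w) :
    ∃ C, ∀ x, ‖w x‖ ≤ C := by
  obtain ⟨C, hC⟩ := hT.isCompact_closure.exists_bound_of_continuousOn hw.continuousOn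
  refine ⟨max C 0, fun x => ?_⟩
  by_cases hx : x ∈ closure D
  · exact (hC x hx).trans (le_max_left _ _)
  · rw [hw.eq_zero x hx, norm_zero]
    exact le_max_right _ _

theorem IsConforming.ae_differentiableAt (hT : IsCellCover T D) (hw : IsConforming T D w) :
    ∀ᵐ x, DifferentiableAt ℝ w x := by
  filter_upwards [hT.ae_mem_interior] with x hx
  by_cases hxD : x ∈ closure D
  · obtain ⟨K, hK, hxK⟩ := hx hxD
    obtain ⟨g, hg, hgK⟩ := hw.piecewise K hK
    refine (hg.differentiable one_ne_zero x).congr_of_eventuallyEq ?_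
    exact hgK.eventuallyEq_of_mem (mem_interior_iff_mem_nhds.1 hxK)
  · refine (differentiableAt_const (0 : F)).congr_of_eventuallyEq ?_
    filter_upwards [isClosed_closure.isOpen_compl.mem_nhds hxD] with y hy using hw.eq_zero y hy

theorem IsConforming.exists_fderiv_bound (hT : IsCellCover T D) (hw : IsConforming T D w) :
    ∃ C, ∀ᵐ x, ‖fderiv ℝ w x‖ ≤ C := by
  have h : ∀ K ∈ T, ∃ C, ∀ x ∈ interior K, ‖fderiv ℝ w x‖ ≤ C := by
    intro K hK
    obtain ⟨g, hg, hgK⟩ := hw.piecewise K hK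
    obtain ⟨C, hC⟩ := (hT.isCompact K hK).exists_bound_of_continuousOn
      (hg.continuous_fderiv one_ne_zero).continuousOn
    refine ⟨C, fun x hx => ?_⟩
    have he : w =ᶠ[𝓝 x] g := hgK.eventuallyEq_of_mem (mem_interior_iff_mem_nhds.1 hx)
    rw [he.fderiv_eq]
    exact hC x (interior_subset hx)
  choose! C hC using h
  obtain ⟨B, hB⟩ := (hT.finite.image C).bddAbove
  refine ⟨max B 0, ?_⟩
  filter_upwards [hT.ae_mem_interior] with x hx
  by_cases hxD : x ∈ closure D
  · obtain ⟨K, hK, hxK⟩ := hx hxD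
    exact ((hC K hK x hxK).trans (hB (mem_image_of_mem _ hK))).trans (le_max_left _ _)
  · have he : w =ᶠ[𝓝 x] fun _ => (0 : F) := by
      filter_upwards [isClosed_closure.isOpen_compl.mem_nhds hxD] with y hy using hw.eq_zero y hy
    rw [he.fderiv_eq]
    simp

/-- Continuity carries the vanishing to the closure, and the extension by zero handles the rest.
Hence the `L²` inner product is definite on spaces of genuine functions. -/
theorem IsConforming.eq_zero_of_ae (hw : IsConforming T D w) (hD : IsOpen D)
    (h : ∀ᵐ x ∂(volume.restrict D), w x = 0) : w = 0 := by
  have h1 : EqOn w (fun _ => 0) D :=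
    Measure.eqOn_open_of_ae_eq h hD (hw.continuousOn.mono subset_closure) continuousOn_const
  ext1 x
  by_cases hx : x ∈ closure D
  · exact h1.of_subset_closure hw.continuousOn continuousOn_const subset_closure subset_rfl hx
  · exact hw.eq_zero x hx

theorem IsConforming.memLp_top [FiniteDimensional ℝ F] [MeasurableSpace F] [BorelSpace F]
    (hT : IsCellCover T D) (hw : IsConforming T D w) (m : Measure (Vec d)) : MemLp w ⊤ m := by
  obtain ⟨C, hC⟩ := hw.exists_bound hT
  exact memLp_top_of_bound hw.measurable.aestronglyMeasurable C (ae_of_all _ hC)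

theorem IsConforming.memLp_fderiv [FiniteDimensional ℝ F]
    (hT : IsCellCover T D) (hw : IsConforming T D w) {m : Measure (Vec d)} (hm : m ≪ volume) :
    MemLp (fderiv ℝ w) ⊤ m := by
  obtain ⟨C, hC⟩ := hw.exists_fderiv_bound hT
  have : FiniteDimensional ℝ (Vec d →L[ℝ] F) := inferInstance
  exact memLp_top_of_bound (measurable_fderiv ℝ w).stronglyMeasurable.aestronglyMeasurable C
    (hm.ae_le hC)

end Conforming

theorem norm_gradient (w : Vec d → ℝ) (x : Vec d) : ‖∇ w x‖ = ‖fderiv ℝ w x‖ := by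
  simp [gradient]

theorem gradient_add_apply {u v : Vec d → ℝ} {x : Vec d} (hu : DifferentiableAt ℝ u x)
    (hv : DifferentiableAt ℝ v x) : ∇ (u + v) x = ∇ u x + ∇ v x := by
  simp [gradient, fderiv_add hu hv]

theorem gradient_smul_apply (c : ℝ) {u : Vec d → ℝ} {x : Vec d} (hu : DifferentiableAt ℝ u x) :
    ∇ (c • u) x = c • ∇ u x := by
  simp [gradient, fderiv_const_smul hu c]

theorem jac_add_apply {u v : Vec d → Vec d} {x : Vec d} (hu : DifferentiableAt ℝ u x)
    (hv : DifferentiableAt ℝ v x) : jac (u + v) x = jac u x + jac v x := by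
  ext i j
  simp [jac, fderiv_add hu hv]

theorem jac_smul_apply (c : ℝ) {u : Vec d → Vec d} {x : Vec d} (hu : DifferentiableAt ℝ u x) :
    jac (c • u) x = c • jac u x := by
  ext i j
  simp [jac, fderiv_const_smul hu c]

variable {T : Set (Set (Vec d))} {D : Set (Vec d)} {m : Measure (Vec d)}

theorem IsConforming.memLp_gradient {w : Vec d → ℝ} (hT : IsCellCover T D)
    (hw : IsConforming T D w) (hm : m ≪ volume) : MemLp (∇ w) ⊤ m := by
  have h := hw.memLp_fderiv hT hm
  refine h.of_le ?_ (ae_of_all _ fun x => (norm_gradient w x).le)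
  exact (InnerProductSpace.toDual ℝ (Vec d)).symm.continuous.comp_aestronglyMeasurable h.1

theorem IsConforming.memLp_jac {w : Vec d → Vec d} (hT : IsCellCover T D)
    (hw : IsConforming T D w) (hm : m ≪ volume) (i j : Fin d) :
    MemLp (fun x => jac w x i j) ⊤ m :=
  (hw.memLp_fderiv hT hm).continuousLinearMap_comp
    ((EuclideanSpace.proj i : Vec d →L[ℝ] ℝ).comp
      (ContinuousLinearMap.apply ℝ (Vec d) (EuclideanSpace.single j 1)))

theorem IsConforming.memLp_dvg {w : Vec d → Vec d} (hT : IsCellCover T D)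
    (hw : IsConforming T D w) (hm : m ≪ volume) : MemLp (dvg w) ⊤ m := by
  have h : dvg w = fun x => ∑ i, jac w x i i := rfl
  rw [h]
  exact memLp_finsetSum _ fun i _ => hw.memLp_jac hT hm i i

theorem IsConforming.memLp_strain {w : Vec d → Vec d} (hT : IsCellCover T D)
    (hw : IsConforming T D w) (hm : m ≪ volume) (i j : Fin d) :
    MemLp (fun x => strain w x i j) ⊤ m := by
  have h : (fun x => strain w x i j) = fun x => (1 / 2 : ℝ) * (jac w x i j + jac w x j i) := by
    ext x
    simp [strain]
  rw [h]
  exact ((hw.memLp_jac hT hm i j).add (hw.memLp_jac hT hm j i)).const_mul _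

/-! ### Finite-dimensional convex minimization -/

section Abstract

variable {V : Type*} [AddCommGroup V] [Module ℝ V]

/-- If `a w w = 0`, then `a (v + t • w) (v + t • w)` is affine in `t`; being nonnegative, it has
slope zero. -/
theorem apply_eq_zero_of_apply_self_eq_zero (a : V →ₗ[ℝ] V →ₗ[ℝ] ℝ) (hs : ∀ v w, a v w = a w v)
    (hp : ∀ v, 0 ≤ a v v) {w : V} (hw : a w w = 0) : a w = 0 := by
  ext v
  have key : ∀ t : ℝ, 0 ≤ a v v + 2 * t * a w v := by
    intro t
    have h := hp (v + t • w)
    simp only [map_add, map_smul, LinearMap.add_apply, LinearMap.smul_apply, smul_eq_mul, hw,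
      hs v w] at h
    linarith
  by_contra h
  simp only [LinearMap.zero_apply] at h
  -- This value of `t` would make the affine function equal to -1.
  have h1 := key (-(a v v + 1) / (2 * a w v))
  have h2 : 2 * (-(a v v + 1) / (2 * a w v)) * a w v = -(a v v + 1) := by
    field_simp
  linarith

theorem surjective_of_posDef [FiniteDimensional ℝ V] (m : V →ₗ[ℝ] V →ₗ[ℝ] ℝ)
    (hm : ∀ v, m v v = 0 → v = 0) : Function.Surjective m := by
  have hinj : Function.Injective m := by
    refine (injective_iff_map_eq_zero m).2 fun v hv => hm v ?_
    rw [hv, LinearMap.zero_apply]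
  exact (LinearMap.injective_iff_surjective_of_finrank_eq_finrank
    (Subspace.dual_finrank_eq (K := ℝ) (V := V)).symm).1 hinj

/-- In the convex combination of the two lower bounds taken at z = a x + b y, the linear terms
cancel. -/
theorem convexOn_of_subgradient {E : V → ℝ} {E' : V → V →ₗ[ℝ] ℝ}
    (h : ∀ v w, E v + E' v (w - v) ≤ E w) : ConvexOn ℝ univ E := by
  refine ⟨convex_univ, fun x _ y _ a b ha hb hab => ?_⟩
  set z := a • x + b • y
  have h1 := mul_le_mul_of_nonneg_left (h z x) ha
  have h2 := mul_le_mul_of_nonneg_left (h z y) hb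
  have h3 : a * E' z (x - z) + b * E' z (y - z) = 0 := by
    have : a • (x - z) + b • (y - z) = 0 := by
      have h4 : a • (x - z) + b • (y - z) = (a • x + b • y) - (a + b) • z := by module
      rw [h4, hab, one_smul, sub_self]
    rw [← smul_eq_mul, ← smul_eq_mul, ← map_smul, ← map_smul, ← map_add, this, map_zero]
  simp only [smul_eq_mul]
  have h4 : a * E z + b * E z = E z := by rw [← add_mul, hab, one_mul]
  linarith

theorem eq_zero_of_forall_le_add_sq {L C : ℝ} (h : ∀ t : ℝ, |t| ≤ 1 → 0 ≤ t * L + C * t ^ 2) :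
    L = 0 := by
  have hd : HasDerivAt (fun t : ℝ => t * L + C * t ^ 2) L 0 := by
    have h1 := ((hasDerivAt_id (0 : ℝ)).mul_const L).fun_add
      (((hasDerivAt_id (0 : ℝ)).fun_pow 2).const_mul C)
    simpa using h1
  refine IsLocalMin.hasDerivAt_eq_zero (f := fun t : ℝ => t * L + C * t ^ 2) ?_ hd
  filter_upwards [Metric.closedBall_mem_nhds (0 : ℝ) one_pos] with t ht
  have := h t (by simpa using ht)
  simpa using this

/-- Convex functions on a finite-dimensional normed space are continuous. The statement is pulled
back to `W` because `V` carries no topology. -/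
theorem continuous_of_subgradient {W : Type*} [NormedAddCommGroup W] [NormedSpace ℝ W]
    [FiniteDimensional ℝ W] {E : V → ℝ} {E' : V → V →ₗ[ℝ] ℝ}
    (h : ∀ v w, E v + E' v (w - v) ≤ E w) (φ₀ : V) (f : W →ₗ[ℝ] V) :
    Continuous fun w => E (φ₀ + f w) := by
  have hc : ConvexOn ℝ univ fun w => E (φ₀ + f w) := by
    refine convexOn_of_subgradient (E' := fun w => (E' (φ₀ + f w)).comp f) fun v w => ?_
    have h1 := h (φ₀ + f v) (φ₀ + f w)
    simpa using h1
  exact continuousOn_univ.1 (hc.continuousOn isOpen_univ)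

/-- Implicit gradient step for a smooth convex energy `E` that is bounded below, in the degenerate
metric given by the positive semidefinite form `a`. -/
theorem exists_gradient_step [FiniteDimensional ℝ V] (m a : V →ₗ[ℝ] V →ₗ[ℝ] ℝ)
    (hms : ∀ v w, m v w = m w v) (hm : ∀ v, m v v = 0 → v = 0)
    (has : ∀ v w, a v w = a w v) (ha : ∀ v, 0 ≤ a v v)
    {E : V → ℝ} {E' : V → V →ₗ[ℝ] ℝ} (hE : ∀ v w, E v + E' v (w - v) ≤ E w)
    (hE2 : ∀ v w, ∃ C, ∀ t : ℝ, |t| ≤ 1 → E (v + t • w) ≤ E v + t * E' v w + C * t ^ 2)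
    {C₀ : ℝ} (hb : ∀ v, C₀ ≤ E v) {τ : ℝ} (hτ : 0 < τ) (φ₀ : V) :
    ∃ φ μ : V, (∀ v, m φ v = m φ₀ v - τ * a μ v) ∧ ∀ v, E' φ v = m μ v := by
  have hsurj := surjective_of_posDef m hm
  have hinj : Function.Injective m := by
    refine (injective_iff_map_eq_zero m).2 fun v hv => hm v ?_
    rw [hv, LinearMap.zero_apply]
  let e : V ≃ₗ[ℝ] Module.Dual ℝ V := LinearEquiv.ofBijective m ⟨hinj, hsurj⟩
  -- `B` represents `a` with respect to `m`, so the first equation reads φ = φ₀ - τ B μ.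
  let B : V →ₗ[ℝ] V := e.symm.toLinearMap ∘ₗ a
  have hB : ∀ w v, m (B w) v = a w v := by
    intro w v
    have h1 : e (B w) = a w := e.apply_symm_apply (a w)
    exact congrArg (fun l : V →ₗ[ℝ] ℝ => l v) h1
  -- The form `a` may be degenerate, as the mobility form is on constants. On a complement of its
  -- kernel it is an inner product, which gives coercivity.
  obtain ⟨W, hW⟩ := Submodule.exists_isCompl (LinearMap.ker a)
  let core : InnerProductSpace.Core ℝ W :=
    { inner := fun x y => a x y
      conj_inner_symm := fun x y => by simpa using has y x
      re_inner_nonneg := fun x => by simpa using ha x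
      add_left := fun x y z => by simp
      smul_left := fun x y r => by simp
      definite := fun x hx => by
        have h1 : (x : V) ∈ LinearMap.ker a :=
          apply_eq_zero_of_apply_self_eq_zero a has ha hx
        have h2 : (x : V) ∈ LinearMap.ker a ⊓ W := ⟨h1, x.2⟩
        rw [hW.inf_eq_bot] at h2
        exact Subtype.ext ((Submodule.mem_bot ℝ).1 h2) }
  let _ : NormedAddCommGroup W := core.toNormedAddCommGroup
  let _ : InnerProductSpace ℝ W := InnerProductSpace.ofCore core.toCore
  have hnorm : ∀ w : W, ‖w‖ ^ 2 = a w w := fun w => (real_inner_self_eq_norm_sq w).symm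
  let f : W →ₗ[ℝ] V := (-τ) • (B ∘ₗ W.subtype)
  have hf : ∀ w : W, f w = (-τ) • B w := fun w => rfl
  -- With φ = φ₀ - τ B w, the squared distance from φ₀ in the metric dual to `a`, divided by 2τ, is
  -- τ/2 a(w, w).
  let J : W → ℝ := fun w => E (φ₀ + f w) + τ / 2 * ‖w‖ ^ 2
  have hJc : Continuous J :=
    (continuous_of_subgradient hE φ₀ f).add (by fun_prop)
  have : ProperSpace W := FiniteDimensional.proper_real W
  have hJt : Tendsto J (cocompact W) atTop := by
    have h1 : Tendsto (fun w : W => τ / 2 * ‖w‖ ^ 2) (cocompact W) atTop :=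
      ((tendsto_pow_atTop two_ne_zero).comp (tendsto_norm_cocompact_atTop (E := W))).const_mul_atTop
        (by positivity)
    exact tendsto_atTop_add_left_of_le _ C₀ (fun w => hb _) h1
  obtain ⟨w, hw⟩ := hJc.exists_forall_le hJt
  set φ := φ₀ + f w with hφ
  -- Stationarity of `J` at the minimizer, divided by τ.
  have hcrit : ∀ u : W, E' φ (B u) = a w u := by
    intro u
    obtain ⟨C, hC⟩ := hE2 φ (f u)
    have h0 : E' φ (f u) + τ * a w u = 0 := by
      refine eq_zero_of_forall_le_add_sq (C := C + τ / 2 * a u u) fun t ht => ?_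
      have h1 : J w ≤ J (w + t • u) := hw _
      have h2 : J (w + t • u) = E (φ + t • f u) + τ / 2 * ‖w + t • u‖ ^ 2 := by
        simp only [J, map_add, map_smul, hφ, add_assoc]
      have h3 : J w = E φ + τ / 2 * ‖w‖ ^ 2 := rfl
      have h4 := hC t ht
      rw [h2, h3, hnorm, hnorm] at h1
      have h5 : a (w + t • u : W) (w + t • u : W) = a w w + 2 * t * a w u + t ^ 2 * a u u := by
        simp only [Submodule.coe_add, Submodule.coe_smul, map_add, map_smul, LinearMap.add_apply,
          LinearMap.smul_apply, smul_eq_mul, has u w]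
        ring
      rw [h5] at h1
      nlinarith
    rw [hf, map_smul, smul_eq_mul] at h0
    have : τ * (a w u - E' φ (B u)) = 0 := by linarith
    rcases mul_eq_zero.1 this with h | h
    · exact absurd h hτ.ne'
    · linarith
  -- Both sides vanish on the kernel of `a`, so the identity extends from `W` to all of `V`.
  have hcrit' : ∀ u : V, E' φ (B u) = a w u := by
    intro u
    have hu : u ∈ LinearMap.ker a ⊔ W := hW.sup_eq_top ▸ Submodule.mem_top
    obtain ⟨k, hk, u', hu', rfl⟩ := Submodule.mem_sup.1 hu
    have hBk : B k = 0 := by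
      refine hinj ?_
      ext v
      rw [hB, LinearMap.mem_ker.1 hk, map_zero]
    have hak : a w k = 0 := by
      rw [has, LinearMap.mem_ker.1 hk, LinearMap.zero_apply]
    rw [map_add, map_add, map_add, hBk, hak, map_zero]
    simpa using hcrit ⟨u', hu'⟩
  -- The minimizer `w` fixes the potential only modulo the kernel of `a`; the second equation
  -- selects the representative, and `a μ = a w` follows from stationarity.
  obtain ⟨μ, hμ⟩ := hsurj (E' φ)
  have hμw : ∀ v, a μ v = a w v := by
    intro v
    rw [has, ← hB, hms, hμ, hcrit']
  refine ⟨φ, μ, fun v => ?_, fun v => by rw [hμ]⟩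
  rw [hμw, ← hB, hφ, hf, map_add, map_smul, LinearMap.add_apply, LinearMap.smul_apply, smul_eq_mul]
  ring

end Abstract

/-! ### Linear families of square integrable fields -/

section Fields

variable {α : Type*} [MeasurableSpace α] {m : Measure α}
  {V W : Type*} [AddCommGroup V] [Module ℝ V] [AddCommGroup W] [Module ℝ W]
  {E : Type*} [NormedAddCommGroup E] [InnerProductSpace ℝ E]
  {E₂ : Type*} [NormedAddCommGroup E₂] [InnerProductSpace ℝ E₂]

/-- A family of square integrable fields that depends linearly, almost everywhere, on a
parameter. -/
structure IsL2Field (m : Measure α) (F : V → α → E) : Prop where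
  memLp : ∀ v, MemLp (F v) 2 m
  map_add : ∀ u v, ∀ᵐ x ∂m, F (u + v) x = F u x + F v x
  map_smul : ∀ (c : ℝ) v, ∀ᵐ x ∂m, F (c • v) x = c • F v x

/-- The linear map into `L²` given by a linear family of square integrable fields. -/
noncomputable def field {F : V → α → E} (h : IsL2Field m F) : V →ₗ[ℝ] Lp E 2 m where
  toFun v := (h.memLp v).toLp (F v)
  map_add' u v := by
    rw [← MemLp.toLp_add, MemLp.toLp_eq_toLp_iff]
    exact h.map_add u v
  map_smul' c v := by
    rw [RingHom.id_apply, ← MemLp.toLp_const_smul, MemLp.toLp_eq_toLp_iff]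
    exact h.map_smul c v

theorem coeFn_field {F : V → α → E} (h : IsL2Field m F) (v : V) : field h v =ᵐ[m] F v :=
  (h.memLp v).coeFn_toLp

theorem inner_field {F : V → α → E} (hF : IsL2Field m F) {F' : W → α → E} (hF' : IsL2Field m F')
    (v : V) (w : W) : ⟪field hF v, field hF' w⟫ = ∫ x, ⟪F v x, F' w x⟫ ∂m := by
  rw [L2.inner_def]
  refine integral_congr_ae ?_
  filter_upwards [coeFn_field hF v, coeFn_field hF' w] with x h1 h2
  rw [h1, h2]

theorem integrable_inner_field {F : V → α → E} (hF : IsL2Field m F) {F' : W → α → E}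
    (hF' : IsL2Field m F') (v : V) (w : W) : Integrable (fun x => ⟪F v x, F' w x⟫) m := by
  refine (L2.integrable_inner (𝕜 := ℝ) (field hF v) (field hF' w)).congr ?_
  filter_upwards [coeFn_field hF v, coeFn_field hF' w] with x h1 h2
  rw [h1, h2]

theorem field_eq_zero {F : V → α → E} (hF : IsL2Field m F) {v : V} (h : field hF v = 0) :
    ∀ᵐ x ∂m, F v x = 0 := by
  have h1 : (field hF v : α → E) =ᵐ[m] 0 := by
    rw [h]
    exact Lp.coeFn_zero _ _ _
  filter_upwards [coeFn_field hF v, h1] with x h2 h3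
  rw [← h2, h3, Pi.zero_apply]

theorem IsL2Field.weight {F : V → α → E} (hF : IsL2Field m F) {k : α → ℝ} (hk : MemLp k ⊤ m) :
    IsL2Field m fun v x => k x • F v x where
  memLp v := (hF.memLp v).smul hk
  map_add u v := by
    filter_upwards [hF.map_add u v] with x h
    rw [h, smul_add]
  map_smul c v := by
    filter_upwards [hF.map_smul c v] with x h
    rw [h, smul_comm]

theorem isL2Field_coe (X : Submodule ℝ (Lp E 2 m)) :
    IsL2Field m fun (v : X) x => (v.1 : α → E) x where
  memLp v := Lp.memLp v.1
  map_add u v := Lp.coeFn_add u.1 v.1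
  map_smul c v := Lp.coeFn_smul c v.1

theorem field_coe (X : Submodule ℝ (Lp E 2 m)) (v : X) : field (isL2Field_coe X) v = v.1 :=
  Lp.toLp_coeFn v.1 (Lp.memLp v.1)

theorem inner_field_coe {F : V → α → E} (hF : IsL2Field m F) (X : Submodule ℝ (Lp E 2 m))
    (v : V) (w : X) : ⟪field hF v, w.1⟫ = ∫ x, ⟪F v x, (w.1 : α → E) x⟫ ∂m := by
  have h := inner_field hF (isL2Field_coe X) v w
  rwa [field_coe] at h

theorem inner_coe_field {F : V → α → E} (hF : IsL2Field m F) (X : Submodule ℝ (Lp E 2 m))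
    (v : V) (w : X) : ⟪w.1, field hF v⟫ = ∫ x, ⟪(w.1 : α → E) x, F v x⟫ ∂m := by
  have h := inner_field (isL2Field_coe X) hF w v
  rwa [field_coe] at h

theorem isL2Field_of_memLp_top [IsFiniteMeasure m] {F : V → α → E}
    (hF : ∀ v, MemLp (F v) ⊤ m)
    (hadd : ∀ u v, ∀ᵐ x ∂m, F (u + v) x = F u x + F v x)
    (hsmul : ∀ (c : ℝ) v, ∀ᵐ x ∂m, F (c • v) x = c • F v x) : IsL2Field m F :=
  ⟨fun v => (hF v).mono_exponent le_top, hadd, hsmul⟩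

end Fields

section Instances

variable {d : ℕ} (G : KarstDomain d)

instance : IsFiniteMeasure ((volume : Measure (Vec d)).restrict G.Ω) :=
  ⟨by simpa using G.isBounded_Ω.measure_lt_top⟩

instance : IsFiniteMeasure ((volume : Measure (Vec d)).restrict G.Ωc) :=
  ⟨by simpa using G.isBounded_Ωc.measure_lt_top⟩

instance : IsFiniteMeasure ((volume : Measure (Vec d)).restrict G.Ωm) :=
  ⟨by simpa using G.isBounded_Ωm.measure_lt_top⟩

end Instances

/-! ### Finite element fields -/

section FE

variable {d : ℕ} {T : Set (Set (Vec d))} {D : Set (Vec d)}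
  {F : Type} [NormedAddCommGroup F] [InnerProductSpace ℝ F] [FiniteDimensional ℝ F]

theorem isL2Field_val [MeasurableSpace F] [BorelSpace F] (hT : IsCellCover T D)
    {X : Submodule ℝ (Vec d → F)} (hX : ∀ w ∈ X, IsConforming T D w) (m : Measure (Vec d))
    [IsFiniteMeasure m] : IsL2Field m fun (v : X) x => v.1 x :=
  isL2Field_of_memLp_top (fun v => (hX v.1 v.2).memLp_top hT m) (fun _ _ => ae_of_all _ fun _ => rfl)
    (fun _ _ => ae_of_all _ fun _ => rfl)

theorem isL2Field_grad (hT : IsCellCover T D) {X : Submodule ℝ (Vec d → ℝ)}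
    (hX : ∀ w ∈ X, IsConforming T D w) {m : Measure (Vec d)} [IsFiniteMeasure m]
    (hm : m ≪ volume) : IsL2Field m fun (v : X) x => ∇ v.1 x := by
  refine isL2Field_of_memLp_top (fun v => (hX v.1 v.2).memLp_gradient hT hm) ?_ ?_
  · intro u v
    filter_upwards [hm.ae_le ((hX u.1 u.2).ae_differentiableAt hT),
      hm.ae_le ((hX v.1 v.2).ae_differentiableAt hT)] with x hu hv
    exact gradient_add_apply hu hv
  · intro c v
    filter_upwards [hm.ae_le ((hX v.1 v.2).ae_differentiableAt hT)] with x hv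
    exact gradient_smul_apply c hv

variable {X : Submodule ℝ (Vec d → Vec d)}

theorem isL2Field_dvg (hT : IsCellCover T D) (hX : ∀ w ∈ X, IsConforming T D w)
    {m : Measure (Vec d)} [IsFiniteMeasure m] (hm : m ≪ volume) :
    IsL2Field m fun (v : X) x => dvg v.1 x := by
  refine isL2Field_of_memLp_top (fun v => (hX v.1 v.2).memLp_dvg hT hm) ?_ ?_
  · intro u v
    filter_upwards [hm.ae_le ((hX u.1 u.2).ae_differentiableAt hT),
      hm.ae_le ((hX v.1 v.2).ae_differentiableAt hT)] with x hu hv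
    simp only [dvg, Submodule.coe_add, jac_add_apply hu hv, Matrix.trace_add]
  · intro c v
    filter_upwards [hm.ae_le ((hX v.1 v.2).ae_differentiableAt hT)] with x hv
    simp only [dvg, Submodule.coe_smul, jac_smul_apply c hv, Matrix.trace_smul]

theorem isL2Field_strain (hT : IsCellCover T D) (hX : ∀ w ∈ X, IsConforming T D w)
    {m : Measure (Vec d)} [IsFiniteMeasure m] (hm : m ≪ volume) (i j : Fin d) :
    IsL2Field m fun (v : X) x => strain v.1 x i j := by
  refine isL2Field_of_memLp_top (fun v => (hX v.1 v.2).memLp_strain hT hm i j) ?_ ?_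
  · intro u v
    filter_upwards [hm.ae_le ((hX u.1 u.2).ae_differentiableAt hT),
      hm.ae_le ((hX v.1 v.2).ae_differentiableAt hT)] with x hu hv
    simp only [strain, Submodule.coe_add, jac_add_apply hu hv, Matrix.transpose_add,
      Matrix.smul_apply, Matrix.add_apply, Matrix.transpose_apply, smul_eq_mul]
    ring
  · intro c v
    filter_upwards [hm.ae_le ((hX v.1 v.2).ae_differentiableAt hT)] with x hv
    simp only [strain, Submodule.coe_smul, jac_smul_apply c hv, Matrix.transpose_smul,
      Matrix.smul_apply, Matrix.add_apply, Matrix.transpose_apply, smul_eq_mul]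
    ring

/-- The components of a family of continuous fields along a bounded direction field. -/
theorem isL2Field_component (hT : IsCellCover T D) (hX : ∀ w ∈ X, IsConforming T D w)
    {m : Measure (Vec d)} [IsFiniteMeasure m] {t : Vec d → Vec d} (ht : Measurable t)
    (ht1 : ∀ᵐ x ∂m, ‖t x‖ = 1) : IsL2Field m fun (v : X) x => ⟪v.1 x, t x⟫ := by
  refine isL2Field_of_memLp_top (fun v => ?_) (fun u v => ae_of_all _ fun x => ?_)
    (fun c v => ae_of_all _ fun x => ?_)
  · obtain ⟨C, hC⟩ := (hX v.1 v.2).exists_bound hT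
    refine memLp_top_of_bound
      ((hX v.1 v.2).measurable.inner (𝕜 := ℝ) ht).aestronglyMeasurable C ?_
    filter_upwards [ht1] with x hx
    refine (norm_inner_le_norm _ _).trans ?_
    rw [hx, mul_one]
    exact hC x
  · exact inner_add_left _ _ _
  · exact real_inner_smul_left _ _ _

end FE

/-! ### Bounds for viscosity, mobility, friction and resistance -/

section Coefficients

variable {d : ℕ} {G : KarstDomain d} (P : Params G) {φ : Vec d → ℝ}

theorem Params.ν_pos (r : ℝ) : 0 < P.ν r := by
  obtain ⟨c, C, hc, h⟩ := P.bounds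
  exact hc.trans_le (h r).1

theorem Params.M_pos (r : ℝ) : 0 < P.M r := by
  obtain ⟨c, C, hc, h⟩ := P.bounds
  exact hc.trans_le (h r).2.2.1

theorem Params.memLp_ν (hφ : Measurable φ) (m : Measure (Vec d)) :
    MemLp (fun x => P.ν (φ x)) ⊤ m := by
  obtain ⟨c, C, hc, h⟩ := P.bounds
  refine memLp_top_of_bound (P.measurable_ν.comp hφ).aestronglyMeasurable C (ae_of_all _ fun x => ?_)
  rw [Real.norm_of_nonneg (P.ν_pos _).le]
  exact (h _).2.1

theorem Params.memLp_M (hφ : Measurable φ) (m : Measure (Vec d)) :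
    MemLp (fun x => P.M (φ x)) ⊤ m := by
  obtain ⟨c, C, hc, h⟩ := P.bounds
  refine memLp_top_of_bound (P.measurable_M.comp hφ).aestronglyMeasurable C (ae_of_all _ fun x => ?_)
  rw [Real.norm_of_nonneg (P.M_pos _).le]
  exact (h _).2.2.2

/-- Each diagonal entry is a value of the quadratic form at a unit vector. The bound holds up to the
closure, hence on the interface, where friction divides by √trace. -/
theorem Params.exists_trace_lower_bound (hd : 1 ≤ d) :
    ∃ c > 0, ∀ x ∈ closure G.Ωm, c ≤ (P.perm x).trace := by
  obtain ⟨c, C, hc, h⟩ := P.bounds_perm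
  refine ⟨c, hc, fun x hx => ?_⟩
  have h1 : ∀ i, c ≤ P.perm x i i := by
    intro i
    have := (h x hx (Pi.single i 1)).1
    simpa using this
  calc c ≤ d * c := le_mul_of_one_le_left hc.le (by exact_mod_cast hd)
    _ = ∑ _i : Fin d, c := by simp
    _ ≤ (P.perm x).trace := Finset.sum_le_sum fun i _ => h1 i

theorem Params.memLp_friction (hd : 1 ≤ d) (hφ : Measurable φ) :
    MemLp (fun x => P.ν (φ x) / Real.sqrt (P.perm x).trace) ⊤ G.dS := by
  obtain ⟨c, hc, h⟩ := P.exists_trace_lower_bound hd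
  have hmeas : Measurable fun x => (P.perm x).trace :=
    Finset.measurable_sum _ fun i _ => P.measurable_perm i i
  have h1 : MemLp (fun x => (Real.sqrt (P.perm x).trace)⁻¹) ⊤ G.dS := by
    refine memLp_top_of_bound hmeas.sqrt.inv.aestronglyMeasurable (Real.sqrt c)⁻¹ ?_
    filter_upwards [G.ae_dS_mem] with x hx
    rw [Real.norm_of_nonneg (by positivity)]
    have h2 := h x (frontier_subset_closure hx.2)
    have h3 := Real.sqrt_pos.2 hc
    gcongr
  simp only [div_eq_mul_inv]
  exact h1.mul' (P.memLp_ν hφ _)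

/-- The inverse permeability as a linear map of Euclidean space. -/
noncomputable def Params.resist (x : Vec d) : Vec d →ₗ[ℝ] Vec d := Matrix.toEuclideanLin (P.perm x)⁻¹

/-- Coercivity of Π makes it invertible and is then applied to Π⁻¹ξ. The resulting inequality serves
twice: it makes the drag nonnegative and, by Cauchy–Schwarz, bounds Π⁻¹ by 1/c. -/
theorem Params.exists_perm_bound : ∃ c > 0, ∀ x ∈ closure G.Ωm, ∀ ξ : Fin d → ℝ,
    c * (((P.perm x)⁻¹ *ᵥ ξ) ⬝ᵥ ((P.perm x)⁻¹ *ᵥ ξ)) ≤ ξ ⬝ᵥ ((P.perm x)⁻¹ *ᵥ ξ) := by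
  obtain ⟨c, C, hc, h⟩ := P.bounds_perm
  refine ⟨c, hc, fun x hx ξ => ?_⟩
  have hu : IsUnit (P.perm x).det := by
    rw [isUnit_iff_ne_zero]
    intro h0
    obtain ⟨v, hv, hv0⟩ := Matrix.exists_mulVec_eq_zero_iff.2 h0
    have h1 := (h x hx v).1
    rw [hv0, dotProduct_zero] at h1
    have h2 : 0 < v ⬝ᵥ v := by
      have h3 := dotProduct_self_eq_zero.not.2 hv
      have h4 : 0 ≤ v ⬝ᵥ v := Finset.sum_nonneg fun i _ => mul_self_nonneg _
      exact lt_of_le_of_ne h4 (Ne.symm h3)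
    nlinarith
  have h1 := (h x hx ((P.perm x)⁻¹ *ᵥ ξ)).1
  rw [Matrix.mulVec_mulVec, Matrix.mul_nonsing_inv _ hu, Matrix.one_mulVec,
    dotProduct_comm _ ξ] at h1
  exact h1

theorem Params.inner_resist (x u v : Vec d) :
    ⟪P.resist x u, v⟫ = ((P.perm x)⁻¹ *ᵥ u.ofLp) ⬝ᵥ v.ofLp := by
  rw [resist, EuclideanSpace.inner_eq_star_dotProduct, dotProduct_comm]
  simp

theorem Params.exists_resist_bound : ∃ c > 0, ∀ x ∈ closure G.Ωm, ∀ u : Vec d,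
    c * ‖P.resist x u‖ ^ 2 ≤ ⟪P.resist x u, u⟫ := by
  obtain ⟨c, hc, h⟩ := P.exists_perm_bound
  refine ⟨c, hc, fun x hx u => ?_⟩
  have h1 := h x hx u.ofLp
  rw [← real_inner_self_eq_norm_sq, P.inner_resist, P.inner_resist]
  rw [dotProduct_comm u.ofLp] at h1
  simpa [resist] using h1

theorem Params.measurable_resist_entry (i j : Fin d) : Measurable fun x => (P.perm x)⁻¹ i j := by
  have hdet : ∀ (g : Vec d → Matrix (Fin d) (Fin d) ℝ), (∀ i j, Measurable fun x => g x i j) →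
      Measurable fun x => (g x).det := by
    intro g hg
    simp only [Matrix.det_apply]
    exact Finset.measurable_sum _ fun σ _ =>
      (Finset.measurable_prod _ fun i _ => hg _ _).const_smul _
  simp only [Matrix.inv_def, Matrix.smul_apply, Ring.inverse_eq_inv, smul_eq_mul,
    Matrix.adjugate_apply]
  refine (hdet _ P.measurable_perm).inv.mul (hdet _ fun a b => ?_)
  simp only [Matrix.updateRow_apply]
  split_ifs
  · exact measurable_const
  · exact P.measurable_perm a b

theorem Params.isL2Field_resist {X : Type*} [AddCommGroup X] [Module ℝ X] {F : X → Vec d → Vec d}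
    (hF : IsL2Field (volume.restrict G.Ωm) F) :
    IsL2Field (volume.restrict G.Ωm) fun v x => P.resist x (F v x) where
  memLp v := by
    obtain ⟨c, hc, h⟩ := P.exists_resist_bound
    refine ((hF.memLp v).const_smul c⁻¹).of_le ?_ ?_
    · have h1 : (fun x => P.resist x (F v x)) =
          fun x => WithLp.toLp 2 fun i => ∑ j, (P.perm x)⁻¹ i j * F v x j := by
        ext x i
        simp [resist, Matrix.mulVec, dotProduct]
      rw [h1]
      refine (PiLp.continuous_toLp 2 _).comp_aestronglyMeasurable ?_
      refine (aemeasurable_pi_lambda _ fun i => ?_).aestronglyMeasurable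
      refine Finset.aemeasurable_fun_sum _ fun j _ => ?_
      refine (P.measurable_resist_entry i j).aemeasurable.mul ?_
      have h2 : Measurable fun y : Vec d => y j := by fun_prop
      exact h2.comp_aemeasurable (hF.memLp v).1.aemeasurable
    · filter_upwards [ae_restrict_mem G.isOpen_Ωm.measurableSet] with x hx
      have h1 := h x (subset_closure hx) (F v x)
      have h2 := real_inner_le_norm (P.resist x (F v x)) (F v x)
      rw [Pi.smul_apply, norm_smul, Real.norm_of_nonneg (inv_nonneg.2 hc.le), inv_mul_eq_div,
        le_div_iff₀ hc]
      rcases (norm_nonneg (P.resist x (F v x))).eq_or_lt with h0 | h0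
      · rw [← h0, zero_mul]
        exact norm_nonneg _
      · refine le_of_mul_le_mul_left ?_ h0
        linarith [h1.trans h2]
  map_add u v := by
    filter_upwards [hF.map_add u v] with x h
    rw [h, map_add]
  map_smul c v := by
    filter_upwards [hF.map_smul c v] with x h
    rw [h, map_smul]

end Coefficients

/-! ### The terms of the scheme as inner products -/

noncomputable section

variable {d : ℕ} {G : KarstDomain d}

theorem restrict_absolutelyContinuous_volume (D : Set (Vec d)) :
    (volume.restrict D : Measure (Vec d)) ≪ volume :=
  Measure.restrict_le_self.absolutelyContinuous

/-! ### Operators on the phase functions -/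

section Phase

variable (S : FESpaces G)

theorem isL2Field_phaseVal : IsL2Field (volume.restrict G.Ω) fun (v : S.Y) x => v.1 x :=
  isL2Field_val S.isCellCover S.conforming_Y _

/-- Restriction of the phase functions to `Ω`. -/
def phaseVal : S.Y →ₗ[ℝ] L2 ℝ G.Ω := field (isL2Field_phaseVal S)

theorem isL2Field_phaseGrad (D : Set (Vec d)) [IsFiniteMeasure (volume.restrict D)] :
    IsL2Field (volume.restrict D) fun (v : S.Y) x => ∇ v.1 x :=
  isL2Field_grad S.isCellCover S.conforming_Y (restrict_absolutelyContinuous_volume D)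

/-- The gradients of the phase functions on `Ω`. -/
def phaseGrad : S.Y →ₗ[ℝ] L2 (Vec d) G.Ω := field (isL2Field_phaseGrad S G.Ω)

theorem phaseVal_injective {v : S.Y} (h : phaseVal S v = 0) : v = 0 :=
  Subtype.ext ((S.conforming_Y v.1 v.2).eq_zero_of_ae G.isOpen_Ω
    (field_eq_zero (isL2Field_phaseVal S) h))

/-- Phase functions are bounded and `p` is bounded on a product of compact intervals. This covers
every nonlinear integrand below; three slots suffice for the new, the competing and the old phase
variable. -/
theorem integrable_phase {p : ℝ × ℝ × ℝ → ℝ} (hp : Continuous p) (u v w : S.Y) :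
    Integrable (fun x => p (u.1 x, v.1 x, w.1 x)) (volume.restrict G.Ω) := by
  obtain ⟨A, hA⟩ := (S.conforming_Y u.1 u.2).exists_bound S.isCellCover
  obtain ⟨B, hB⟩ := (S.conforming_Y v.1 v.2).exists_bound S.isCellCover
  obtain ⟨C, hC⟩ := (S.conforming_Y w.1 w.2).exists_bound S.isCellCover
  obtain ⟨R, hR⟩ := ((isCompact_closedBall (0 : ℝ) A).prod
    ((isCompact_closedBall (0 : ℝ) B).prod
      (isCompact_closedBall (0 : ℝ) C))).exists_bound_of_continuousOn hp.continuousOn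
  have hmeas := (S.conforming_Y u.1 u.2).measurable.prodMk
    ((S.conforming_Y v.1 v.2).measurable.prodMk (S.conforming_Y w.1 w.2).measurable)
  refine Integrable.of_bound (hp.measurable.comp hmeas).aestronglyMeasurable R (ae_of_all _ fun x => ?_)
  exact hR _ ⟨by simpa using hA x, by simpa using hB x, by simpa using hC x⟩

end Phase

/-! ### Velocities, pressures and the inf-sup conditions -/

section Flow

variable (S : FESpaces G)

/-- Restriction of the conduit velocities to `Ωc`. -/
def velC : S.Xc →ₗ[ℝ] L2 (Vec d) G.Ωc :=
  field (isL2Field_val S.isMesh_c.isCellCover S.conforming_Xc (volume.restrict G.Ωc))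

/-- The divergence of the conduit velocities. -/
def divC : S.Xc →ₗ[ℝ] L2 ℝ G.Ωc :=
  field (isL2Field_dvg S.isMesh_c.isCellCover S.conforming_Xc
    (restrict_absolutelyContinuous_volume G.Ωc))

/-- The gradients of the matrix pressures. -/
def presGradM : S.Mm →ₗ[ℝ] L2 (Vec d) G.Ωm :=
  field (isL2Field_grad S.isMesh_m.isCellCover S.conforming_Mm
    (restrict_absolutelyContinuous_volume G.Ωm))

theorem velC_injective {v : S.Xc} (h : velC S v = 0) : v = 0 :=
  Subtype.ext ((S.conforming_Xc v.1 v.2).eq_zero_of_ae G.isOpen_Ωc (field_eq_zero _ h))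

theorem bc_eq (v : S.Xc) (q : S.Mc) : bc G v.1 q.1 = -⟪divC S v, q.1⟫ := by
  rw [bc, divC, inner_field_coe]
  simp only [Real.inner_apply]

theorem bm_eq (v : S.Xm) (q : S.Mm) : bm G v.1 q.1 = ⟪v.1, presGradM S q⟫ := by
  rw [bm, presGradM, inner_coe_field]

theorem pressureC_eq_zero {q : S.Mc} (h : ∀ v : S.Xc, ⟪divC S v, q.1⟫ = 0) : q = 0 := by
  obtain ⟨c, hc, hq⟩ := S.infsup_c
  have h1 := hq q.1 q.2
  have h2 : ∀ v : S.Xc, ∫ x in G.Ωc, dvg v.1 x * (q.1 : Vec d → ℝ) x = 0 := by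
    intro v
    have := bc_eq S v q
    rw [h v, bc] at this
    linarith
  -- Every quotient is zero, the one at `v = 0` by the convention 0/0 = 0, so the supremum is zero.
  simp only [h2, zero_div, ciSup_const] at h1
  have h3 : ‖q.1‖ = 0 := by
    have := norm_nonneg q.1
    nlinarith
  exact Subtype.ext (norm_eq_zero.1 h3)

theorem pressureM_eq_zero {q : S.Mm} (h : ∀ v : S.Xm, ⟪v.1, presGradM S q⟫ = 0) : q = 0 := by
  obtain ⟨c, hc, hq⟩ := S.infsup_m
  have h1 := hq q.1 q.2
  have h2 : ∀ v : S.Xm, ∫ x in G.Ωm, ⟪(v.1 : Vec d → Vec d) x, ∇ q.1 x⟫ = 0 := by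
    intro v
    have := bm_eq S v q
    rwa [h v, bm] at this
  simp only [h2, zero_div, ciSup_const] at h1
  have hval := isL2Field_val S.isMesh_m.isCellCover S.conforming_Mm (volume.restrict G.Ωm)
  have h3 : Real.sqrt (∫ x in G.Ωm, q.1 x ^ 2) = 0 := by
    have := Real.sqrt_nonneg (∫ x in G.Ωm, q.1 x ^ 2)
    nlinarith
  have h4 : ⟪field hval q, field hval q⟫ = ∫ x in G.Ωm, q.1 x ^ 2 := by
    rw [inner_field]
    simp only [Real.inner_apply, sq]
  rw [Real.sqrt_eq_zero (h4 ▸ real_inner_self_nonneg), ← h4, inner_self_eq_zero] at h3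
  exact Subtype.ext ((S.conforming_Mm q.1 q.2).eq_zero_of_ae G.isOpen_Ωm (field_eq_zero hval h3))

end Flow

/-! ### Traces on the interface -/

section Interface

variable [NeZero d]

instance (G : KarstDomain d) : IsFiniteMeasure G.dS := G.isFiniteMeasure_dS NeZero.one_le

variable (N : InterfaceFrame G) (S : FESpaces G)

theorem isL2Field_tangential (i : Fin (d - 1)) :
    IsL2Field G.dS fun (v : S.Xc) x => ⟪v.1 x, N.t i x⟫ :=
  isL2Field_component S.isMesh_c.isCellCover S.conforming_Xc (N.measurable_t i)
    (N.orthonormal_t.mono fun _ hx => hx.1 i)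

/-- The tangential components of the conduit velocities on the interface. -/
def tangential (i : Fin (d - 1)) : S.Xc →ₗ[ℝ] Lp ℝ 2 G.dS := field (isL2Field_tangential N S i)

/-- The normal component of the conduit velocities on the interface. -/
def normalC : S.Xc →ₗ[ℝ] Lp ℝ 2 G.dS :=
  field (isL2Field_component S.isMesh_c.isCellCover S.conforming_Xc N.measurable_n
    (N.isOuterNormal.mono fun _ hx => hx.1))

/-- The traces of the matrix pressures on the interface. -/
def traceM : S.Mm →ₗ[ℝ] Lp ℝ 2 G.dS :=
  field (isL2Field_val S.isMesh_m.isCellCover S.conforming_Mm G.dS)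

theorem flux_eq (v : S.Xc) (q : S.Mm) : flux N v.1 q.1 = ⟪traceM S q, normalC N S v⟫ := by
  rw [flux, traceM, normalC, inner_field]
  simp only [Real.inner_apply]

end Interface

/-! ### Operators with coefficients frozen at the old phase variable -/

section Coefficients

variable (P : Params G) {S : FESpaces G} (φ₀ : S.Y)

theorem measurable_phase : Measurable φ₀.1 := (S.conforming_Y φ₀.1 φ₀.2).measurable

/-- The gradients of the phase functions, weighted by the mobility. -/
def mobGrad : S.Y →ₗ[ℝ] L2 (Vec d) G.Ω :=
  field ((isL2Field_phaseGrad S G.Ω).weight (P.memLp_M (measurable_phase φ₀) _))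

theorem isL2Field_cap (D : Set (Vec d)) [IsFiniteMeasure (volume.restrict D)] :
    IsL2Field (volume.restrict D) fun (v : S.Y) x => φ₀.1 x • ∇ v.1 x :=
  (isL2Field_phaseGrad S D).weight ((S.conforming_Y φ₀.1 φ₀.2).memLp_top S.isCellCover _)

/-- The capillary force in the conduit, as a function of the chemical potential. -/
def capC : S.Y →ₗ[ℝ] L2 (Vec d) G.Ωc := field (isL2Field_cap φ₀ G.Ωc)

/-- The capillary force in the matrix, as a function of the chemical potential. -/
def capM : S.Y →ₗ[ℝ] L2 (Vec d) G.Ωm := field (isL2Field_cap φ₀ G.Ωm)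

/-- The drag force in the matrix. -/
def drag : S.Xm →ₗ[ℝ] L2 (Vec d) G.Ωm :=
  field ((P.isL2Field_resist (isL2Field_coe S.Xm)).weight (P.memLp_ν (measurable_phase φ₀) _))

theorem am_eq (u v : S.Xm) : am P φ₀.1 u.1 v.1 = ⟪drag P φ₀ u, v.1⟫ := by
  rw [drag, inner_field_coe, am]
  simp only [real_inner_smul_left, P.inner_resist]

theorem am_nonneg (u : S.Xm) : 0 ≤ am P φ₀.1 u.1 u.1 := by
  obtain ⟨c, hc, h⟩ := P.exists_resist_bound
  refine integral_nonneg_of_ae ?_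
  filter_upwards [ae_restrict_mem G.isOpen_Ωm.measurableSet] with x hx
  refine mul_nonneg (P.ν_pos _).le ?_
  rw [← P.inner_resist]
  exact le_trans (by positivity) (h x (subset_closure hx) _)

theorem mobGrad_nonneg (v : S.Y) : 0 ≤ ⟪mobGrad P φ₀ v, phaseGrad S v⟫ := by
  rw [mobGrad, phaseGrad, inner_field]
  refine integral_nonneg fun x => ?_
  rw [real_inner_smul_left]
  exact mul_nonneg (P.M_pos _).le real_inner_self_nonneg

theorem mobGrad_symm (u v : S.Y) :
    ⟪mobGrad P φ₀ u, phaseGrad S v⟫ = ⟪mobGrad P φ₀ v, phaseGrad S u⟫ := by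
  rw [mobGrad, phaseGrad, inner_field, inner_field]
  refine integral_congr_ae (ae_of_all _ fun x => ?_)
  beta_reduce
  rw [real_inner_smul_left, real_inner_smul_left, real_inner_comm]

theorem isL2Field_strainC (i j : Fin d) :
    IsL2Field (volume.restrict G.Ωc) fun (v : S.Xc) x => strain v.1 x i j :=
  isL2Field_strain S.isMesh_c.isCellCover S.conforming_Xc
    (restrict_absolutelyContinuous_volume G.Ωc) i j

variable (N : InterfaceFrame G)

theorem ac_nonneg (u : S.Xc) : 0 ≤ ac N P φ₀.1 u.1 u.1 := by
  refine add_nonneg (mul_nonneg zero_le_two (integral_nonneg fun x => ?_))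
    (Finset.sum_nonneg fun i _ => mul_nonneg P.α_nonneg (integral_nonneg fun x => ?_))
  · exact mul_nonneg (P.ν_pos _).le (Finset.sum_nonneg fun i _ =>
      Finset.sum_nonneg fun j _ => mul_self_nonneg _)
  · simp only [Pi.zero_apply, mul_assoc]
    exact mul_nonneg (div_nonneg (P.ν_pos _).le (Real.sqrt_nonneg _)) (mul_self_nonneg _)

variable [NeZero d]

/-- The viscous form, as a bilinear form on the conduit velocities. -/
def viscous : S.Xc →ₗ[ℝ] S.Xc →ₗ[ℝ] ℝ :=
  (2 : ℝ) • ∑ i, ∑ j, (innerₗ (L2 ℝ G.Ωc)).compl₁₂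
      (field ((isL2Field_strainC (S := S) i j).weight (P.memLp_ν (measurable_phase φ₀) _)))
      (field (isL2Field_strainC (S := S) i j)) +
    ∑ i, P.α • (innerₗ (Lp ℝ 2 G.dS)).compl₁₂
      (field ((isL2Field_tangential N S i).weight
        (P.memLp_friction NeZero.one_le (measurable_phase φ₀))))
      (tangential N S i)

theorem ac_eq (u v : S.Xc) : ac N P φ₀.1 u.1 v.1 = viscous P φ₀ N u v := by
  have h1 : (∫ x in G.Ωc, P.ν (φ₀.1 x) * frob (strain u.1 x) (strain v.1 x)) =
      ∑ i, ∑ j, ⟪field ((isL2Field_strainC (S := S) i j).weight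
        (P.memLp_ν (measurable_phase φ₀) _)) u, field (isL2Field_strainC (S := S) i j) v⟫ := by
    simp only [inner_field]
    have hint : ∀ i j, Integrable (fun x => ⟪P.ν (φ₀.1 x) • strain u.1 x i j, strain v.1 x i j⟫)
        (volume.restrict G.Ωc) := fun i j => integrable_inner_field
      ((isL2Field_strainC (S := S) i j).weight (P.memLp_ν (measurable_phase φ₀) _))
      (isL2Field_strainC (S := S) i j) u v
    simp_rw [← integral_finsetSum _ fun j _ => hint _ j]
    rw [← integral_finsetSum _ fun i _ => integrable_finsetSum _ fun j _ => hint i j]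
    simp only [frob, Finset.mul_sum, Real.inner_apply, smul_eq_mul, mul_assoc]
  simp only [ac, h1, viscous, LinearMap.add_apply, LinearMap.smul_apply, LinearMap.sum_apply,
    LinearMap.compl₁₂_apply, innerₗ_apply_apply, smul_eq_mul, tangential, inner_field,
    Real.inner_apply, mul_assoc]

end Coefficients

end

/-! ### The equations of the scheme in Hilbert space form -/

noncomputable section

variable {d : ℕ} {G : KarstDomain d} (P : Params G) {S : FESpaces G}

theorem memLp_cubic (φ φ₀ : S.Y) :
    MemLp (fun x => φ.1 x ^ 3 - φ₀.1 x) 2 (volume.restrict G.Ω) := by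
  have h := integrable_phase S (p := fun p => (p.1 ^ 3 - p.2.1) ^ 2) (by fun_prop) φ φ₀ φ₀
  refine (memLp_two_iff_integrable_sq ?_).2 h
  have h1 : Measurable fun x => φ.1 x ^ 3 - φ₀.1 x :=
    ((measurable_phase φ).pow_const 3).sub (measurable_phase φ₀)
  exact h1.aestronglyMeasurable

/-- The nonlinearity `φ³ - φ₀`. -/
def cubic (φ φ₀ : S.Y) : L2 ℝ G.Ω := (memLp_cubic φ φ₀).toLp _

theorem inner_cubic (φ φ₀ v : S.Y) :
    ⟪cubic φ φ₀, phaseVal S v⟫ = ∫ x in G.Ω, (φ.1 x ^ 3 - φ₀.1 x) * v.1 x := by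
  rw [L2.inner_def]
  refine integral_congr_ae ?_
  filter_upwards [(memLp_cubic φ φ₀).coeFn_toLp, coeFn_field (isL2Field_phaseVal S) v] with x h1 h2
  rw [Real.inner_apply, cubic, phaseVal, h1, h2]

theorem potential_eq (φ φ₀ μ v : S.Y) :
    P.γ * (1 / P.ε * (∫ x in G.Ω, (φ.1 x ^ 3 - φ₀.1 x) * v.1 x)
        + P.ε * ∫ x in G.Ω, ⟪∇ φ.1 x, ∇ v.1 x⟫) - (∫ x in G.Ω, μ.1 x * v.1 x) =
      P.γ * (1 / P.ε * ⟪cubic φ φ₀, phaseVal S v⟫ + P.ε * ⟪phaseGrad S φ, phaseGrad S v⟫)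
        - ⟪phaseVal S μ, phaseVal S v⟫ := by
  rw [inner_cubic, phaseGrad, phaseVal, inner_field, inner_field]
  simp only [Real.inner_apply]

variable {P} in
-- The scalar φᵏ is moved from the velocity onto ∇v. The implicit part of the intermediate velocity
-- then becomes symmetric in `μ` and `v`, and can join the mobility form.
theorem phase_transport_eq [NeZero d] (τ : ℝ) (s : State S) (μ v : S.Y) :
    ∫ x in G.Ω, ⟪s.φ.1 x • ubar P τ s μ.1 x, ∇ v.1 x⟫ =
      ⟪velC S s.uc, capC s.φ v⟫ - τ / P.ρ₀ * ⟪capC s.φ μ, capC s.φ v⟫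
        + (⟪s.um.1, capM s.φ v⟫ - τ * P.χ / P.ρ₀ * ⟪capM s.φ μ, capM s.φ v⟫) := by
  have hu := isL2Field_val S.isMesh_c.isCellCover S.conforming_Xc (volume.restrict G.Ωc)
  have ic1 := integrable_inner_field hu (isL2Field_cap s.φ G.Ωc) s.uc v
  have ic2 := integrable_inner_field (isL2Field_cap s.φ G.Ωc) (isL2Field_cap s.φ G.Ωc) μ v
  have im1 := integrable_inner_field (isL2Field_coe S.Xm) (isL2Field_cap s.φ G.Ωm) s.um v
  have im2 := integrable_inner_field (isL2Field_cap s.φ G.Ωm) (isL2Field_cap s.φ G.Ωm) μ v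
  have hc : (fun x => ⟪s.φ.1 x • ubar P τ s μ.1 x, ∇ v.1 x⟫) =ᵐ[volume.restrict G.Ωc]
      fun x => ⟪s.uc.1 x, s.φ.1 x • ∇ v.1 x⟫ -
        τ / P.ρ₀ * ⟪s.φ.1 x • ∇ μ.1 x, s.φ.1 x • ∇ v.1 x⟫ := by
    filter_upwards [ae_restrict_mem G.isOpen_Ωc.measurableSet] with x hx
    have hx' : x ∉ G.Ωm := fun h => Set.disjoint_left.1 G.disjoint hx h
    simp only [ubar, indicator_of_mem hx, indicator_of_notMem hx', zero_add, real_inner_smul_left,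
      real_inner_smul_right, inner_sub_left]
    ring
  have hm : (fun x => ⟪s.φ.1 x • ubar P τ s μ.1 x, ∇ v.1 x⟫) =ᵐ[volume.restrict G.Ωm]
      fun x => ⟪(s.um.1 : Vec d → Vec d) x, s.φ.1 x • ∇ v.1 x⟫ -
        τ * P.χ / P.ρ₀ * ⟪s.φ.1 x • ∇ μ.1 x, s.φ.1 x • ∇ v.1 x⟫ := by
    filter_upwards [ae_restrict_mem G.isOpen_Ωm.measurableSet] with x hx
    have hx' : x ∉ G.Ωc := fun h => Set.disjoint_left.1 G.disjoint h hx
    simp only [ubar, indicator_of_mem hx, indicator_of_notMem hx', add_zero, real_inner_smul_left,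
      real_inner_smul_right, inner_sub_left]
    ring
  rw [G.setIntegral_Ω NeZero.one_le ((ic1.sub (ic2.const_mul _)).congr hc.symm)
    ((im1.sub (im2.const_mul _)).congr hm.symm), integral_congr_ae hc, integral_congr_ae hm,
    integral_sub ic1 (ic2.const_mul _), integral_sub im1 (im2.const_mul _), integral_const_mul,
    integral_const_mul]
  rw [capC, capM, velC, inner_field, inner_field, inner_coe_field, inner_field]

theorem phase_eq [NeZero d] (τ : ℝ) (s : State S) (φ μ v : S.Y) :
    (∫ x in G.Ω, (φ.1 x - s.φ.1 x) / τ * v.1 x)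
      + (∫ x in G.Ω, P.M (s.φ.1 x) * ⟪∇ μ.1 x, ∇ v.1 x⟫)
      - (∫ x in G.Ω, ⟪s.φ.1 x • ubar P τ s μ.1 x, ∇ v.1 x⟫) =
    τ⁻¹ * ⟪phaseVal S (φ - s.φ), phaseVal S v⟫ + ⟪mobGrad P s.φ μ, phaseGrad S v⟫
      - (⟪velC S s.uc, capC s.φ v⟫ - τ / P.ρ₀ * ⟪capC s.φ μ, capC s.φ v⟫
        + (⟪s.um.1, capM s.φ v⟫ - τ * P.χ / P.ρ₀ * ⟪capM s.φ μ, capM s.φ v⟫)) := by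
  have h1 : ∫ x in G.Ω, (φ.1 x - s.φ.1 x) / τ * v.1 x =
      τ⁻¹ * ⟪phaseVal S (φ - s.φ), phaseVal S v⟫ := by
    rw [phaseVal, inner_field, ← integral_const_mul]
    congr with x
    simp only [Real.inner_apply, Submodule.coe_sub, Pi.sub_apply]
    ring
  have h2 : ∫ x in G.Ω, P.M (s.φ.1 x) * ⟪∇ μ.1 x, ∇ v.1 x⟫ =
      ⟪mobGrad P s.φ μ, phaseGrad S v⟫ := by
    rw [mobGrad, phaseGrad, inner_field]
    simp only [real_inner_smul_left]
  rw [phase_transport_eq, h1, h2]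

theorem inertiaC_eq (τ : ℝ) (u u₀ v : S.Xc) :
    (∫ x in G.Ωc, ⟪τ⁻¹ • (u.1 x - u₀.1 x), v.1 x⟫) = τ⁻¹ * ⟪velC S (u - u₀), velC S v⟫ := by
  rw [velC, inner_field, ← integral_const_mul]
  simp only [real_inner_smul_left, Submodule.coe_sub, Pi.sub_apply]

theorem inertiaM_eq (τ : ℝ) (u u₀ v : S.Xm) :
    (∫ x in G.Ωm, ⟪τ⁻¹ • ((u.1 : Vec d → Vec d) x - u₀.1 x), v.1 x⟫) =
      τ⁻¹ * ⟪u.1 - u₀.1, v.1⟫ := by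
  rw [L2.inner_def, ← integral_const_mul]
  refine integral_congr_ae ?_
  filter_upwards [Lp.coeFn_sub u.1 u₀.1] with x hx
  rw [hx, real_inner_smul_left, Pi.sub_apply]

theorem capillaryC_eq (φ₀ μ : S.Y) (v : S.Xc) :
    (∫ x in G.Ωc, ⟪φ₀.1 x • ∇ μ.1 x, v.1 x⟫) = ⟪capC φ₀ μ, velC S v⟫ := by
  rw [capC, velC, inner_field]

theorem capillaryM_eq (φ₀ μ : S.Y) (v : S.Xm) :
    (∫ x in G.Ωm, ⟪φ₀.1 x • ∇ μ.1 x, v.1 x⟫) = ⟪capM φ₀ μ, v.1⟫ := by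
  rw [capM, inner_field_coe]

variable [NeZero d] (N : InterfaceFrame G)

theorem stokes_eq (τ : ℝ) (φ₀ μ : S.Y) (u u₀ v : S.Xc) (p q : S.Mc) (r : S.Mm) :
    P.ρ₀ * (∫ x in G.Ωc, ⟪τ⁻¹ • (u.1 x - u₀.1 x), v.1 x⟫)
      + ac N P φ₀.1 u.1 v.1 + bc G v.1 p.1 + flux N v.1 r.1 - bc G u.1 q.1
      + (∫ x in G.Ωc, ⟪φ₀.1 x • ∇ μ.1 x, v.1 x⟫) =
    P.ρ₀ * (τ⁻¹ * ⟪velC S (u - u₀), velC S v⟫) + viscous P φ₀ N u v - ⟪divC S v, p.1⟫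
      + ⟪traceM S r, normalC N S v⟫ + ⟪divC S u, q.1⟫ + ⟪capC φ₀ μ, velC S v⟫ := by
  rw [inertiaC_eq, ac_eq, bc_eq, bc_eq, flux_eq, capillaryC_eq]
  ring

theorem darcy_eq (τ : ℝ) (φ₀ μ : S.Y) (u u₀ v : S.Xm) (w : S.Xc) (p q : S.Mm) :
    P.ρ₀ / P.χ * (∫ x in G.Ωm, ⟪τ⁻¹ • ((u.1 : Vec d → Vec d) x - u₀.1 x), v.1 x⟫)
      + am P φ₀.1 u.1 v.1 + bm G v.1 p.1 + (∫ x in G.Ωm, ⟪φ₀.1 x • ∇ μ.1 x, v.1 x⟫)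
      - flux N w.1 q.1 - bm G u.1 q.1 =
    P.ρ₀ / P.χ * (τ⁻¹ * ⟪u.1 - u₀.1, v.1⟫) + ⟪drag P φ₀ u, v.1⟫ + ⟪v.1, presGradM S p⟫
      + ⟪capM φ₀ μ, v.1⟫ - ⟪traceM S q, normalC N S w⟫ - ⟪u.1, presGradM S q⟫ := by
  rw [inertiaM_eq, am_eq, bm_eq, bm_eq, flux_eq, capillaryM_eq]

omit [NeZero d] in
theorem energy_eq (s : State S) :
    energy P s = P.ρ₀ / 2 * ‖velC S s.uc‖ ^ 2 + P.ρ₀ / (2 * P.χ) * ‖s.um.1‖ ^ 2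
      + P.γ * (1 / P.ε * (∫ x in G.Ω, 1 / 4 * (s.φ.1 x ^ 2 - 1) ^ 2)
        + P.ε / 2 * ‖phaseGrad S s.φ‖ ^ 2) := by
  have h1 := integrable_phase S (p := fun p => 1 / 4 * (p.1 ^ 2 - 1) ^ 2) (by fun_prop) s.φ s.φ s.φ
  have h2 := integrable_inner_field (isL2Field_phaseGrad S G.Ω) (isL2Field_phaseGrad S G.Ω) s.φ s.φ
  simp only [real_inner_self_eq_norm_sq] at h2
  rw [energy, integral_add (h1.const_mul _) (h2.const_mul _), integral_const_mul,
    integral_const_mul, integral_const_mul, integral_const_mul, integral_const_mul]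
  simp only [← real_inner_self_eq_norm_sq]
  rw [velC, phaseGrad, inner_field, inner_field, L2.inner_def]

omit [NeZero d] in
theorem dissipation_eq (φ φ₀ : S.Y) (u u₀ : S.Xc) (w w₀ : S.Xm) :
    -(P.γ * P.ε / 2 * ∫ x in G.Ω, ‖∇ (φ.1 - φ₀.1) x‖ ^ 2)
          - P.ρ₀ / 4 * (∫ x in G.Ωc, ‖u.1 x - u₀.1 x‖ ^ 2)
          - P.ρ₀ / (4 * P.χ) * (∫ x in G.Ωm, ‖(w.1 : Vec d → Vec d) x - w₀.1 x‖ ^ 2) =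
    -(P.γ * P.ε / 2 * ‖phaseGrad S (φ - φ₀)‖ ^ 2) - P.ρ₀ / 4 * ‖velC S (u - u₀)‖ ^ 2
      - P.ρ₀ / (4 * P.χ) * ‖w.1 - w₀.1‖ ^ 2 := by
  have h : ∫ x in G.Ωm, ‖(w.1 : Vec d → Vec d) x - w₀.1 x‖ ^ 2 = ‖w.1 - w₀.1‖ ^ 2 := by
    rw [← real_inner_self_eq_norm_sq, L2.inner_def]
    refine integral_congr_ae ?_
    filter_upwards [Lp.coeFn_sub w.1 w₀.1] with x hx
    rw [hx, real_inner_self_eq_norm_sq, Pi.sub_apply]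
  rw [h]
  simp only [← real_inner_self_eq_norm_sq]
  rw [velC, phaseGrad, inner_field, inner_field]
  rfl

end

/-! ### The Cahn–Hilliard step -/

noncomputable section

variable {d : ℕ} {G : KarstDomain d} (P : Params G) {S : FESpaces G}

section CahnHilliard

variable (φ₀ : S.Y)

/-- The convex part of the free energy, with the concave part linearized at the old phase
variable. -/
def splitEnergy (φ : S.Y) : ℝ :=
  P.γ * (1 / P.ε * (∫ x in G.Ω, (φ.1 x ^ 4 / 4 - φ₀.1 x * φ.1 x))
    + P.ε / 2 * ‖phaseGrad S φ‖ ^ 2)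

/-- The derivative of `splitEnergy`. -/
def splitEnergyDeriv (φ : S.Y) : S.Y →ₗ[ℝ] ℝ :=
  P.γ • ((1 / P.ε) • (innerₗ (L2 ℝ G.Ω) (cubic φ φ₀)).comp (phaseVal S) +
    P.ε • (innerₗ (L2 (Vec d) G.Ω) (phaseGrad S φ)).comp (phaseGrad S))

theorem splitEnergyDeriv_apply (φ v : S.Y) : splitEnergyDeriv P φ₀ φ v =
    P.γ * (1 / P.ε * ⟪cubic φ φ₀, phaseVal S v⟫ + P.ε * ⟪phaseGrad S φ, phaseGrad S v⟫) :=
  rfl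

theorem splitEnergy_subgradient (v w : S.Y) :
    splitEnergy P φ₀ v + splitEnergyDeriv P φ₀ v (w - v) ≤ splitEnergy P φ₀ w := by
  have i1 := integrable_phase S (p := fun p => p.1 ^ 4 / 4 - p.2.2 * p.1) (by fun_prop) v w φ₀
  have i2 := integrable_phase S (p := fun p => (p.1 ^ 3 - p.2.2) * (p.2.1 - p.1)) (by fun_prop)
    v w φ₀
  have i3 := integrable_phase S (p := fun p => p.2.1 ^ 4 / 4 - p.2.2 * p.2.1) (by fun_prop) v w φ₀
  have h1 : (∫ x in G.Ω, (v.1 x ^ 4 / 4 - φ₀.1 x * v.1 x)) + ⟪cubic v φ₀, phaseVal S (w - v)⟫ ≤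
      ∫ x in G.Ω, (w.1 x ^ 4 / 4 - φ₀.1 x * w.1 x) := by
    rw [inner_cubic]
    refine (integral_add i1 i2).symm.trans_le (integral_mono (i1.add i2) i3 fun x => ?_)
    -- This is four times the convexity gap w⁴/4 - v⁴/4 - v³(w - v); the part linear in the phase
    -- variable has no gap.
    have h : 0 ≤ (w.1 x - v.1 x) ^ 2 * ((w.1 x + v.1 x) ^ 2 + 2 * v.1 x ^ 2) := by positivity
    linarith
  have h2 : ‖phaseGrad S v‖ ^ 2 / 2 + ⟪phaseGrad S v, phaseGrad S (w - v)⟫ ≤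
      ‖phaseGrad S w‖ ^ 2 / 2 := by
    have h := sq_nonneg ‖phaseGrad S w - phaseGrad S v‖
    rw [norm_sub_sq_real] at h
    rw [map_sub, inner_sub_right, real_inner_self_eq_norm_sq, real_inner_comm]
    linarith
  have hγ := P.γ_pos
  have hε := P.ε_pos
  have h3 := mul_le_mul_of_nonneg_left h1 (one_div_pos.2 hε).le
  have h4 := mul_le_mul_of_nonneg_left h2 hε.le
  have h5 := mul_le_mul_of_nonneg_left (add_le_add h3 h4) hγ.le
  rw [splitEnergyDeriv_apply, splitEnergy, splitEnergy]
  linarith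

theorem splitEnergy_quadratic_bound (v w : S.Y) : ∃ C, ∀ t : ℝ, |t| ≤ 1 →
    splitEnergy P φ₀ (v + t • w) ≤
      splitEnergy P φ₀ v + t * splitEnergyDeriv P φ₀ v w + C * t ^ 2 := by
  -- The Taylor remainder of the quartic is t²(3/2 v²w² + t v w³ + t² w⁴/4). For |t| ≤ 1, Young's
  -- inequality bounds it by t²(2v²w² + w⁴).
  refine ⟨P.γ * (1 / P.ε * (∫ x in G.Ω, (2 * v.1 x ^ 2 * w.1 x ^ 2 + w.1 x ^ 4))
    + P.ε / 2 * ‖phaseGrad S w‖ ^ 2), fun t ht => ?_⟩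
  have ht2 : t ^ 2 ≤ 1 := (sq_le_one_iff_abs_le_one t).2 ht
  have i0 := integrable_phase S
    (p := fun p => (p.1 + t * p.2.1) ^ 4 / 4 - p.2.2 * (p.1 + t * p.2.1)) (by fun_prop) v w φ₀
  have i1 := integrable_phase S (p := fun p => p.1 ^ 4 / 4 - p.2.2 * p.1) (by fun_prop) v w φ₀
  have i2 := integrable_phase S (p := fun p => (p.1 ^ 3 - p.2.2) * p.2.1) (by fun_prop) v w φ₀
  have i3 := integrable_phase S (p := fun p => 2 * p.1 ^ 2 * p.2.1 ^ 2 + p.2.1 ^ 4) (by fun_prop)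
    v w φ₀
  have h1 : (∫ x in G.Ω, ((v + t • w).1 x ^ 4 / 4 - φ₀.1 x * (v + t • w).1 x)) ≤
      (∫ x in G.Ω, (v.1 x ^ 4 / 4 - φ₀.1 x * v.1 x)) + t * ⟪cubic v φ₀, phaseVal S w⟫
        + (∫ x in G.Ω, (2 * v.1 x ^ 2 * w.1 x ^ 2 + w.1 x ^ 4)) * t ^ 2 := by
    rw [inner_cubic, ← integral_const_mul, ← integral_mul_const]
    refine le_trans (integral_mono i0 ((i1.add (i2.const_mul t)).add (i3.mul_const (t ^ 2)))
      fun x => ?_) (le_of_eq ?_)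
    · have h4 : (v + t • w).1 x = v.1 x + t * w.1 x := rfl
      simp only [Pi.add_apply, h4]
      have h5 : 0 ≤ t ^ 2 * (v.1 x * w.1 x - t * w.1 x ^ 2) ^ 2 := by positivity
      have h6 : 0 ≤ t ^ 2 * w.1 x ^ 4 * (1 - t ^ 2) :=
        mul_nonneg (by positivity) (by linarith)
      have h7 : 0 ≤ t ^ 2 * w.1 x ^ 4 := by positivity
      linarith
    · rw [integral_add' (i1.add (i2.const_mul t)) (i3.mul_const (t ^ 2)),
        integral_add' i1 (i2.const_mul t)]
  have h2 : ‖phaseGrad S (v + t • w)‖ ^ 2 / 2 = ‖phaseGrad S v‖ ^ 2 / 2 +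
      t * ⟪phaseGrad S v, phaseGrad S w⟫ + ‖phaseGrad S w‖ ^ 2 / 2 * t ^ 2 := by
    rw [map_add, map_smul, norm_add_sq_real, real_inner_smul_right, norm_smul, mul_pow,
      Real.norm_eq_abs, sq_abs]
    ring
  have hγ := P.γ_pos
  have hε := P.ε_pos
  have h3 := mul_le_mul_of_nonneg_left h1 (one_div_pos.2 hε).le
  have h4 := mul_le_mul_of_nonneg_left h2.le hε.le
  have h5 := mul_le_mul_of_nonneg_left (add_le_add h3 h4) hγ.le
  rw [splitEnergyDeriv_apply, splitEnergy, splitEnergy]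
  linarith

/-- Pointwise, v⁴/4 ≥ v²/2 - 1/4 and v²/2 - φ₀v ≥ -φ₀²/2. -/
theorem splitEnergy_lower_bound (v : S.Y) :
    P.γ * (1 / P.ε * ∫ x in G.Ω, (-(φ₀.1 x ^ 2 / 2) - 1 / 4)) ≤ splitEnergy P φ₀ v := by
  have hγ := P.γ_pos
  have hε := P.ε_pos
  have i1 := integrable_phase S (p := fun p => p.1 ^ 4 / 4 - p.2.2 * p.1) (by fun_prop) v v φ₀
  have i2 := integrable_phase S (p := fun p => -(p.2.2 ^ 2 / 2) - 1 / 4) (by fun_prop) v v φ₀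
  have h := integral_mono i2 i1 fun x => by
    have h1 := sq_nonneg (v.1 x ^ 2 - 1)
    have h2 := sq_nonneg (v.1 x - φ₀.1 x)
    dsimp only
    nlinarith
  refine mul_le_mul_of_nonneg_left ?_ hγ.le
  have h3 := mul_le_mul_of_nonneg_left h (one_div_pos.2 hε).le
  have h4 : 0 ≤ P.ε / 2 * ‖phaseGrad S v‖ ^ 2 := by positivity
  exact h3.trans (le_add_of_nonneg_right h4)

/-- The `L²` inner product on the phase functions. -/
def massForm (S : FESpaces G) : S.Y →ₗ[ℝ] S.Y →ₗ[ℝ] ℝ :=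
  (innerₗ (L2 ℝ G.Ω)).compl₁₂ (phaseVal S) (phaseVal S)

theorem massForm_symm (v w : S.Y) : massForm S v w = massForm S w v :=
  real_inner_comm (phaseVal S w) (phaseVal S v)

/-- The mobility form, including the contribution of the intermediate velocity. -/
def mobilityForm (τ : ℝ) : S.Y →ₗ[ℝ] S.Y →ₗ[ℝ] ℝ :=
  (innerₗ (L2 (Vec d) G.Ω)).compl₁₂ (mobGrad P φ₀) (phaseGrad S) +
    (τ / P.ρ₀) • (innerₗ (L2 (Vec d) G.Ωc)).compl₁₂ (capC φ₀) (capC φ₀) +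
    (τ * P.χ / P.ρ₀) • (innerₗ (L2 (Vec d) G.Ωm)).compl₁₂ (capM φ₀) (capM φ₀)

theorem mobilityForm_apply (τ : ℝ) (μ v : S.Y) : mobilityForm P φ₀ τ μ v =
    ⟪mobGrad P φ₀ μ, phaseGrad S v⟫ + τ / P.ρ₀ * ⟪capC φ₀ μ, capC φ₀ v⟫ +
      τ * P.χ / P.ρ₀ * ⟪capM φ₀ μ, capM φ₀ v⟫ :=
  rfl

theorem mobilityForm_symm (τ : ℝ) (μ v : S.Y) :
    mobilityForm P φ₀ τ μ v = mobilityForm P φ₀ τ v μ := by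
  rw [mobilityForm_apply, mobilityForm_apply, mobGrad_symm, real_inner_comm (capC φ₀ μ),
    real_inner_comm (capM φ₀ μ)]

theorem mobilityForm_nonneg {τ : ℝ} (hτ : 0 < τ) (v : S.Y) : 0 ≤ mobilityForm P φ₀ τ v v := by
  have h1 := P.ρ₀_pos
  have h2 := P.χ_pos
  have h3 := mobGrad_nonneg P φ₀ v
  rw [mobilityForm_apply, real_inner_self_eq_norm_sq, real_inner_self_eq_norm_sq]
  positivity

/-- The transport of the phase variable by the old velocity. -/
def transport (s : State S) : S.Y →ₗ[ℝ] ℝ :=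
  (innerₗ (L2 (Vec d) G.Ωc) (velC S s.uc)).comp (capC s.φ) +
    (innerₗ (L2 (Vec d) G.Ωm) s.um.1).comp (capM s.φ)

theorem transport_apply (s : State S) (v : S.Y) :
    transport s v = ⟪velC S s.uc, capC s.φ v⟫ + ⟪s.um.1, capM s.φ v⟫ :=
  rfl

/-- The weak form of the Cahn–Hilliard part of the scheme. -/
def IsCahnHilliardStep (τ : ℝ) (s : State S) (φ μ : S.Y) : Prop :=
  (∀ v, massForm S (φ - s.φ) v + τ * mobilityForm P s.φ τ μ v = τ * transport s v) ∧
    ∀ v, splitEnergyDeriv P s.φ φ v = massForm S μ v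

theorem massForm_definite {v : S.Y} (h : massForm S v v = 0) : v = 0 :=
  phaseVal_injective S (inner_self_eq_zero.1 h)

theorem exists_isCahnHilliardStep {τ : ℝ} (hτ : 0 < τ) (s : State S) :
    ∃ φ μ, IsCahnHilliardStep P τ s φ μ := by
  have := S.finite_Y
  have hm : ∀ v : S.Y, massForm S v v = 0 → v = 0 := fun v => massForm_definite
  -- The explicit transport is represented by `w` in the mass inner product and absorbed into the
  -- starting point φᵏ + τ w.
  obtain ⟨w, hw⟩ := surjective_of_posDef (massForm S) hm (transport s)
  obtain ⟨φ, μ, h1, h2⟩ := exists_gradient_step (massForm S) (mobilityForm P s.φ τ)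
    massForm_symm hm (mobilityForm_symm P s.φ τ) (mobilityForm_nonneg P s.φ hτ)
    (splitEnergy_subgradient P s.φ) (splitEnergy_quadratic_bound P s.φ)
    (splitEnergy_lower_bound P s.φ) hτ (s.φ + τ • w)
  refine ⟨φ, μ, fun v => ?_, h2⟩
  rw [map_sub, LinearMap.sub_apply, h1, map_add, map_smul, hw, LinearMap.add_apply,
    LinearMap.smul_apply, smul_eq_mul]
  ring

/-- Since (a³ - b³)(a - b) - (a - b)⁴/4 = 3/4 (a - b)²(a + b)², the hypothesis forces the integral
of (φ - ψ)⁴ to vanish. -/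
theorem eq_of_cubic_monotone {φ ψ : S.Y}
    (h : ⟪cubic φ φ₀, phaseVal S (φ - ψ)⟫ ≤ ⟪cubic ψ φ₀, phaseVal S (φ - ψ)⟫) : φ = ψ := by
  have i1 := integrable_phase S (p := fun p => (p.1 ^ 3 - p.2.2) * (p.1 - p.2.1)) (by fun_prop)
    φ ψ φ₀
  have i2 := integrable_phase S (p := fun p => (p.2.1 ^ 3 - p.2.2) * (p.1 - p.2.1)) (by fun_prop)
    φ ψ φ₀
  have i3 := integrable_phase S (p := fun p => (p.1 - p.2.1) ^ 4 / 4) (by fun_prop) φ ψ φ₀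
  have h1 : (∫ x in G.Ω, (φ.1 x - ψ.1 x) ^ 4 / 4) ≤ 0 := by
    rw [inner_cubic, inner_cubic] at h
    have h2 := integral_mono (i2.add i3) i1 fun x => by
      have h3 := sq_nonneg ((φ.1 x - ψ.1 x) * (φ.1 x + ψ.1 x))
      simp only [Pi.add_apply]
      nlinarith
    rw [integral_add' i2 i3] at h2
    dsimp only at h2
    have h4 := h2.trans h
    exact le_of_add_le_add_left (h4.trans_eq (add_zero _).symm)
  have hnn : ∀ x, 0 ≤ (φ.1 x - ψ.1 x) ^ 4 / 4 := fun x => by positivity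
  have h2 := (integral_eq_zero_iff_of_nonneg hnn i3).1 (le_antisymm h1 (integral_nonneg hnn))
  have h3 : φ - ψ = 0 := by
    refine Subtype.ext ((S.conforming_Y _ (φ - ψ).2).eq_zero_of_ae G.isOpen_Ω ?_)
    filter_upwards [h2] with x hx
    have h4 : (φ.1 x - ψ.1 x) ^ 4 = 0 := by
      simp only [Pi.zero_apply] at hx
      linarith
    exact pow_eq_zero_iff (four_ne_zero) |>.1 h4
  exact sub_eq_zero.1 h3

/-- The difference of the phase equations is tested with μ - η, that of the potential equations with
φ - ψ; eliminating the common mass pairing leaves a sum of nonnegative terms equal to zero. As the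
mobility form is only semidefinite, this yields φ = ψ first, and the potential equation then gives μ
= η. -/
theorem IsCahnHilliardStep.unique {τ : ℝ} (hτ : 0 < τ) {s : State S} {φ μ ψ η : S.Y}
    (h : IsCahnHilliardStep P τ s φ μ) (h' : IsCahnHilliardStep P τ s ψ η) : φ = ψ ∧ μ = η := by
  have h1 : massForm S (φ - ψ) (μ - η) + τ * mobilityForm P s.φ τ (μ - η) (μ - η) = 0 := by
    have e1 := h.1 (μ - η)
    have e2 := h'.1 (μ - η)
    have e3 : φ - ψ = (φ - s.φ) - (ψ - s.φ) := by abel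
    rw [e3, map_sub (massForm S), LinearMap.sub_apply, map_sub (mobilityForm P s.φ τ) μ η,
      LinearMap.sub_apply]
    linarith
  have h2 : splitEnergyDeriv P s.φ φ (φ - ψ) - splitEnergyDeriv P s.φ ψ (φ - ψ) =
      massForm S (φ - ψ) (μ - η) := by
    rw [h.2, h'.2, ← LinearMap.sub_apply, ← map_sub, massForm_symm]
  have h3 := mobilityForm_nonneg P s.φ hτ (μ - η)
  have hγ := P.γ_pos
  have hε := P.ε_pos
  have h4 : splitEnergyDeriv P s.φ φ (φ - ψ) - splitEnergyDeriv P s.φ ψ (φ - ψ) =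
      P.γ * (1 / P.ε) * (⟪cubic φ s.φ, phaseVal S (φ - ψ)⟫ - ⟪cubic ψ s.φ, phaseVal S (φ - ψ)⟫) +
        P.γ * P.ε * ‖phaseGrad S (φ - ψ)‖ ^ 2 := by
    have h5 : ‖phaseGrad S (φ - ψ)‖ ^ 2 = ⟪phaseGrad S φ, phaseGrad S (φ - ψ)⟫ -
        ⟪phaseGrad S ψ, phaseGrad S (φ - ψ)⟫ := by
      rw [← real_inner_self_eq_norm_sq, ← inner_sub_left, ← map_sub]
    rw [splitEnergyDeriv_apply, splitEnergyDeriv_apply, h5]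
    ring
  have hφ : φ = ψ := by
    refine eq_of_cubic_monotone s.φ (sub_nonpos.1 ?_)
    have h5 : 0 ≤ P.γ * P.ε * ‖phaseGrad S (φ - ψ)‖ ^ 2 := by positivity
    have h6 : 0 ≤ τ * mobilityForm P s.φ τ (μ - η) (μ - η) := by positivity
    have h7 : 0 < P.γ * (1 / P.ε) := by positivity
    refine nonpos_of_mul_nonpos_right (a := P.γ * (1 / P.ε)) ?_ h7
    linarith
  refine ⟨hφ, sub_eq_zero.1 (massForm_definite ?_)⟩
  rw [map_sub (massForm S), LinearMap.sub_apply, ← h.2, ← h'.2, hφ, sub_self]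

end CahnHilliard

/-! ### The flow step -/

section Flow

variable [NeZero d] (N : InterfaceFrame G) (φ₀ : S.Y)

/-- The bilinear form of the Stokes–Darcy system for the unknowns `(u_c, P_c, u_m, P_m)`. -/
def flowForm (τ : ℝ) : (S.Xc × S.Mc × S.Xm × S.Mm) →ₗ[ℝ] (S.Xc × S.Mc × S.Xm × S.Mm) →ₗ[ℝ] ℝ :=
  LinearMap.mk₂ ℝ (fun U V =>
    P.ρ₀ * (τ⁻¹ * ⟪velC S U.1, velC S V.1⟫) + viscous P φ₀ N U.1 V.1 - ⟪divC S V.1, U.2.1.1⟫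
      + ⟪traceM S U.2.2.2, normalC N S V.1⟫ + ⟪divC S U.1, V.2.1.1⟫
      + (P.ρ₀ / P.χ * (τ⁻¹ * ⟪U.2.2.1.1, V.2.2.1.1⟫) + ⟪drag P φ₀ U.2.2.1, V.2.2.1.1⟫
        + ⟪V.2.2.1.1, presGradM S U.2.2.2⟫ - ⟪traceM S V.2.2.2, normalC N S U.1⟫
        - ⟪U.2.2.1.1, presGradM S V.2.2.2⟫))
    (fun U U' V => by
      simp only [Prod.fst_add, Prod.snd_add, map_add, Submodule.coe_add, inner_add_left,
        inner_add_right, LinearMap.add_apply]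
      ring)
    (fun c U V => by
      simp only [Prod.smul_fst, Prod.smul_snd, map_smul, Submodule.coe_smul, real_inner_smul_left,
        real_inner_smul_right, LinearMap.smul_apply, smul_eq_mul]
      ring)
    (fun U V V' => by
      simp only [Prod.fst_add, Prod.snd_add, map_add, Submodule.coe_add, inner_add_left,
        inner_add_right]
      ring)
    (fun c U V => by
      simp only [Prod.smul_fst, Prod.smul_snd, map_smul, Submodule.coe_smul, real_inner_smul_left,
        real_inner_smul_right, smul_eq_mul]
      ring)

/-- The right-hand side of the Stokes–Darcy system. -/
def flowLoad (τ : ℝ) (s : State S) (μ : S.Y) : (S.Xc × S.Mc × S.Xm × S.Mm) →ₗ[ℝ] ℝ where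
  toFun V := P.ρ₀ * (τ⁻¹ * ⟪velC S s.uc, velC S V.1⟫) - ⟪capC s.φ μ, velC S V.1⟫
    + (P.ρ₀ / P.χ * (τ⁻¹ * ⟪s.um.1, V.2.2.1.1⟫) - ⟪capM s.φ μ, V.2.2.1.1⟫)
  map_add' V V' := by
    simp only [Prod.fst_add, Prod.snd_add, map_add, Submodule.coe_add, inner_add_right]
    ring
  map_smul' c V := by
    simp only [Prod.smul_fst, Prod.smul_snd, map_smul, Submodule.coe_smul, real_inner_smul_right,
      smul_eq_mul, RingHom.id_apply]
    ring

/-- On the diagonal the pressure and interface terms cancel in pairs. The inertia terms are definite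
and the viscous and drag terms nonnegative, so the velocities vanish. -/
theorem flowForm_injective {τ : ℝ} (hτ : 0 < τ) :
    Function.Injective (flowForm P (S := S) N φ₀ τ) := by
  refine (injective_iff_map_eq_zero _).2 ?_
  rintro ⟨u, p, w, q⟩ hU
  have hρ := P.ρ₀_pos
  have hχ := P.χ_pos
  have h0 : ∀ V, flowForm P (S := S) N φ₀ τ (u, p, w, q) V = 0 := fun V => by
    rw [hU, LinearMap.zero_apply]
  simp only [flowForm, LinearMap.mk₂_apply] at h0
  have h1 := h0 (u, p, w, q)
  have hv : 0 ≤ viscous P φ₀ N u u := ac_eq P φ₀ N u u ▸ ac_nonneg P φ₀ N u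
  have hd : 0 ≤ ⟪drag P φ₀ w, w.1⟫ := am_eq P φ₀ w w ▸ am_nonneg P φ₀ w
  have hu0 : 0 ≤ P.ρ₀ * (τ⁻¹ * ⟪velC S u, velC S u⟫) := by
    rw [real_inner_self_eq_norm_sq]
    positivity
  have hw0 : 0 ≤ P.ρ₀ / P.χ * (τ⁻¹ * ⟪w.1, w.1⟫) := by
    rw [real_inner_self_eq_norm_sq]
    positivity
  have hu : u = 0 := by
    refine velC_injective S (inner_self_eq_zero (𝕜 := ℝ).1 ?_)
    have h2 : P.ρ₀ * (τ⁻¹ * ⟪velC S u, velC S u⟫) = 0 := by linarith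
    simpa [hρ.ne', hτ.ne'] using h2
  have hw : w = 0 := by
    refine Subtype.ext (inner_self_eq_zero (𝕜 := ℝ).1 ?_)
    have h2 : P.ρ₀ / P.χ * (τ⁻¹ * ⟪w.1, w.1⟫) = 0 := by linarith
    simpa [hρ.ne', hτ.ne', hχ.ne'] using h2
  subst hu hw
  -- The order matters: the matrix pressure also enters the Stokes equation through the interface,
  -- whereas the Darcy equation does not contain the conduit pressure.
  have hq : q = 0 := pressureM_eq_zero S fun v => by
    have h2 := h0 (0, 0, v, 0)
    simpa using h2
  subst hq
  have hp : p = 0 := pressureC_eq_zero S fun v => by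
    have h2 := h0 (v, 0, 0, 0)
    simpa using h2
  subst hp
  rfl

theorem exists_flowStep {τ : ℝ} (hτ : 0 < τ)
    (L : (S.Xc × S.Mc × S.Xm × S.Mm) →ₗ[ℝ] ℝ) : ∃ U, flowForm P N φ₀ τ U = L := by
  have := S.finite_Xc
  have := S.finite_Mc
  have := S.finite_Xm
  have := S.finite_Mm
  exact (LinearMap.injective_iff_surjective_of_finrank_eq_finrank
    (Subspace.dual_finrank_eq (K := ℝ) (V := S.Xc × S.Mc × S.Xm × S.Mm)).symm).1
    (flowForm_injective P N φ₀ hτ) L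

/-- The scheme consists of the Cahn–Hilliard step followed by the flow step. -/
theorem isStep_iff {τ : ℝ} (hτ : 0 < τ) (s : State S) (z : Unknowns S) :
    IsStep N P τ s z ↔ IsCahnHilliardStep P τ s z.φ z.μ ∧
      flowForm P N s.φ τ (z.uc, z.Pc, z.um, z.Pm) = flowLoad P τ s z.μ := by
  have hphase : ∀ v : S.Y, (τ⁻¹ * ⟪phaseVal S (z.φ - s.φ), phaseVal S v⟫
      + ⟪mobGrad P s.φ z.μ, phaseGrad S v⟫
      - (⟪velC S s.uc, capC s.φ v⟫ - τ / P.ρ₀ * ⟪capC s.φ z.μ, capC s.φ v⟫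
        + (⟪s.um.1, capM s.φ v⟫ - τ * P.χ / P.ρ₀ * ⟪capM s.φ z.μ, capM s.φ v⟫)) = 0) ↔
      massForm S (z.φ - s.φ) v + τ * mobilityForm P s.φ τ z.μ v = τ * transport s v := by
    intro v
    have hm : massForm S (z.φ - s.φ) v = ⟪phaseVal S (z.φ - s.φ), phaseVal S v⟫ := rfl
    rw [mobilityForm_apply, transport_apply, hm]
    constructor
    · intro h
      have h1 : τ * (τ⁻¹ * ⟪phaseVal S (z.φ - s.φ), phaseVal S v⟫) =
          ⟪phaseVal S (z.φ - s.φ), phaseVal S v⟫ := mul_inv_cancel_left₀ hτ.ne' _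
      have h2 := congrArg (τ * ·) h
      simp only [mul_zero] at h2
      linear_combination h2 - h1
    · intro h
      have h1 : τ⁻¹ * τ = 1 := inv_mul_cancel₀ hτ.ne'
      linear_combination τ⁻¹ * h + (⟪velC S s.uc, capC s.φ v⟫ + ⟪s.um.1, capM s.φ v⟫
        - (⟪mobGrad P s.φ z.μ, phaseGrad S v⟫ + τ / P.ρ₀ * ⟪capC s.φ z.μ, capC s.φ v⟫ +
          τ * P.χ / P.ρ₀ * ⟪capM s.φ z.μ, capM s.φ v⟫)) * h1
  constructor
  · intro h
    refine ⟨⟨fun v => (hphase v).1 ?_, fun v => ?_⟩, ?_⟩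
    · rw [← phase_eq]
      exact h.phase v
    · have h1 := h.potential v
      rw [potential_eq] at h1
      exact sub_eq_zero.1 h1
    · refine LinearMap.ext fun V => ?_
      have h1 := h.stokes V.1 V.2.1
      have h2 := h.darcy V.2.2.1 V.2.2.2
      rw [stokes_eq, map_sub, inner_sub_left] at h1
      rw [darcy_eq, inner_sub_left] at h2
      simp only [flowForm, flowLoad, LinearMap.mk₂_apply, LinearMap.coe_mk, AddHom.coe_mk]
      linear_combination h1 + h2
  · rintro ⟨⟨h1, h2⟩, h3⟩
    have h4 : ∀ V, flowForm P N s.φ τ (z.uc, z.Pc, z.um, z.Pm) V = flowLoad P τ s z.μ V :=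
      fun V => by rw [h3]
    simp only [flowForm, flowLoad, LinearMap.mk₂_apply, LinearMap.coe_mk, AddHom.coe_mk] at h4
    refine ⟨fun v => ?_, fun v => ?_, fun v q => ?_, fun v q => ?_⟩
    · rw [phase_eq]
      exact (hphase v).2 (h1 v)
    · rw [potential_eq]
      exact sub_eq_zero.2 (h2 v)
    · rw [stokes_eq, map_sub, inner_sub_left]
      -- Summing the Stokes and Darcy equations loses nothing, because zero test functions in one of
      -- them isolate the other.
      have h5 := h4 (v, q, 0, 0)
      simp only [map_zero, ZeroMemClass.coe_zero, inner_zero_left, inner_zero_right] at h5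
      linear_combination h5
    · rw [darcy_eq, inner_sub_left]
      have h5 := h4 (0, 0, v, q)
      simp only [map_zero, ZeroMemClass.coe_zero, inner_zero_left, inner_zero_right] at h5
      linear_combination h5

theorem existsUnique_isStep {τ : ℝ} (hτ : 0 < τ) (s : State S) :
    ∃! z : Unknowns S, IsStep N P τ s z := by
  obtain ⟨φ, μ, hCH⟩ := exists_isCahnHilliardStep P hτ s
  obtain ⟨⟨u, p, w, q⟩, hU⟩ := exists_flowStep P N s.φ hτ (flowLoad P τ s μ)
  refine ⟨⟨⟨φ, u, w⟩, μ, p, q⟩, (isStep_iff P N hτ s _).2 ⟨hCH, hU⟩, ?_⟩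
  rintro ⟨⟨φ', u', w'⟩, μ', p', q'⟩ hz
  obtain ⟨h1, h2⟩ := (isStep_iff P N hτ s _).1 hz
  obtain ⟨rfl, rfl⟩ := h1.unique P hτ hCH
  have h3 := flowForm_injective P N s.φ hτ (h2.trans hU.symm)
  simp only [Prod.mk.injEq] at h3
  obtain ⟨rfl, rfl, rfl, rfl⟩ := h3
  rfl

end Flow

/-! ### Mass conservation and energy law -/

section Laws

variable {N : InterfaceFrame G} {τ : ℝ} {s : State S} {z : Unknowns S}

/-- The phase equation is tested with the constant one, whose gradient vanishes on the open set Ω.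
-/
theorem IsStep.mass (hτ : 0 < τ) (h : IsStep N P τ s z) :
    (∫ x in G.Ω, z.φ.1 x) = ∫ x in G.Ω, s.φ.1 x := by
  have h1 := h.phase ⟨_, S.one_mem_Y⟩
  have hgrad : ∀ x ∈ G.Ω, ∇ ((closure G.Ω).indicator fun _ => (1 : ℝ)) x = 0 := by
    intro x hx
    have he : (closure G.Ω).indicator (fun _ => (1 : ℝ)) =ᶠ[𝓝 x] fun _ => 1 := by
      filter_upwards [G.isOpen_Ω.mem_nhds hx] with y hy using indicator_of_mem (subset_closure hy) _
    rw [he.gradient_eq]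
    simp
  have e1 : (∫ x in G.Ω, (z.φ.1 x - s.φ.1 x) / τ * (closure G.Ω).indicator (fun _ => (1 : ℝ)) x) =
      ∫ x in G.Ω, (z.φ.1 x - s.φ.1 x) / τ := by
    refine setIntegral_congr_fun G.isOpen_Ω.measurableSet fun x hx => ?_
    simp only [indicator_of_mem (subset_closure hx), mul_one]
  have e2 : (∫ x in G.Ω, P.M (s.φ.1 x) *
      ⟪∇ z.μ.1 x, ∇ ((closure G.Ω).indicator fun _ => (1 : ℝ)) x⟫) = 0 := by
    refine setIntegral_eq_zero_of_forall_eq_zero fun x hx => ?_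
    rw [hgrad x hx, inner_zero_right, mul_zero]
  have e3 : (∫ x in G.Ω, ⟪s.φ.1 x • ubar P τ s z.μ.1 x,
      ∇ ((closure G.Ω).indicator fun _ => (1 : ℝ)) x⟫) = 0 := by
    refine setIntegral_eq_zero_of_forall_eq_zero fun x hx => ?_
    rw [hgrad x hx, inner_zero_right]
  have i1 := integrable_phase S (p := fun p => p.1) (by fun_prop) z.φ z.φ z.φ
  have i2 := integrable_phase S (p := fun p => p.1) (by fun_prop) s.φ s.φ s.φ
  rw [e1, e2, e3, add_zero, sub_zero, integral_div, div_eq_zero_iff, or_iff_left hτ.ne',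
    integral_sub i1 i2] at h1
  exact sub_eq_zero.1 h1

/-- The polarization identity leaves ρ/2 ‖u - u₀‖². Half of it completes the square ρ⁻¹ ‖ρ/2 (u -
u₀) + τη‖² with the coupling term τ⟪u - u₀, η⟫ and the stabilizing term τ²/ρ ‖η‖². -/
theorem kinetic_energy_le {H : Type*} [NormedAddCommGroup H] [InnerProductSpace ℝ H] {ρ : ℝ}
    (hρ : 0 < ρ) (τ : ℝ) (u u₀ η : H) :
    ρ / 2 * ‖u‖ ^ 2 - ρ / 2 * ‖u₀‖ ^ 2 + ρ / 4 * ‖u - u₀‖ ^ 2 ≤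
      ρ * ⟪u - u₀, u⟫ + τ * ⟪η, u⟫ - τ * ⟪u₀, η⟫ + τ * (τ / ρ) * ‖η‖ ^ 2 := by
  have h1 : 0 ≤ ρ⁻¹ * ‖(ρ / 2) • (u - u₀) + τ • η‖ ^ 2 := by positivity
  have h2 : ρ⁻¹ * ‖(ρ / 2) • (u - u₀) + τ • η‖ ^ 2 =
      ρ / 4 * ‖u - u₀‖ ^ 2 + τ * ⟪u - u₀, η⟫ + τ * (τ / ρ) * ‖η‖ ^ 2 := by
    rw [norm_add_sq_real, norm_smul, norm_smul, real_inner_smul_left, real_inner_smul_right,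
      mul_pow, mul_pow, Real.norm_eq_abs, Real.norm_eq_abs, sq_abs, sq_abs]
    field_simp
    ring
  have h3 := norm_sub_sq_real u u₀
  have h4 : ⟪u - u₀, u⟫ = ‖u‖ ^ 2 - ⟪u, u₀⟫ := by
    rw [inner_sub_left, real_inner_self_eq_norm_sq, real_inner_comm]
  have h5 : ⟪u - u₀, η⟫ = ⟪η, u⟫ - ⟪u₀, η⟫ := by
    rw [inner_sub_left, real_inner_comm]
  rw [h2, h5] at h1
  have h6 : ρ * ⟪u - u₀, u⟫ = ρ / 2 * ‖u‖ ^ 2 - ρ / 2 * ‖u₀‖ ^ 2 + ρ / 2 * ‖u - u₀‖ ^ 2 := by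
    rw [h4, h3]
    ring
  linarith

/-- The convex quartic is differentiated at the new value, the concave quadratic at the old one, so
both tangent inequalities have the favourable sign; the gaps are a quarter of `h1` and half of `h2`.
-/
theorem doubleWell_sub_le (φ φ₀ : S.Y) :
    (∫ x in G.Ω, 1 / 4 * (φ.1 x ^ 2 - 1) ^ 2) - (∫ x in G.Ω, 1 / 4 * (φ₀.1 x ^ 2 - 1) ^ 2) ≤
      ⟪cubic φ φ₀, phaseVal S (φ - φ₀)⟫ := by
  have i1 := integrable_phase S (p := fun p => 1 / 4 * (p.1 ^ 2 - 1) ^ 2) (by fun_prop) φ φ₀ φ₀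
  have i2 := integrable_phase S (p := fun p => 1 / 4 * (p.2.1 ^ 2 - 1) ^ 2) (by fun_prop) φ φ₀ φ₀
  have i3 := integrable_phase S (p := fun p => (p.1 ^ 3 - p.2.1) * (p.1 - p.2.1)) (by fun_prop)
    φ φ₀ φ₀
  rw [inner_cubic]
  refine (integral_sub i1 i2).symm.trans_le (integral_mono (i1.sub i2) i3 fun x => ?_)
  have h1 : 0 ≤ (φ.1 x - φ₀.1 x) ^ 2 * ((φ.1 x + φ₀.1 x) ^ 2 + 2 * φ.1 x ^ 2) := by positivity
  have h2 := sq_nonneg (φ.1 x - φ₀.1 x)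
  have h3 : (φ - φ₀ : S.Y).1 x = φ.1 x - φ₀.1 x := rfl
  rw [h3]
  linarith

variable [NeZero d]

/-- With the four test functions chosen, the interface terms of Stokes and Darcy cancel, and the
phase equation supplies exactly the transport and stabilizing terms required by `kinetic_energy_le`
in each subdomain. -/
theorem IsStep.energy_law (hτ : 0 < τ) (h : IsStep N P τ s z) :
    energy P z.toState - energy P s + τ * ac N P s.φ.1 z.uc.1 z.uc.1
        + τ * am P s.φ.1 z.um.1 z.um.1 ≤
      -(P.γ * P.ε / 2 * ‖phaseGrad S (z.φ - s.φ)‖ ^ 2) - P.ρ₀ / 4 * ‖velC S (z.uc - s.uc)‖ ^ 2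
        - P.ρ₀ / (4 * P.χ) * ‖z.um.1 - s.um.1‖ ^ 2 := by
  have hρ := P.ρ₀_pos
  have hχ := P.χ_pos
  have hγ := P.γ_pos
  have hε := P.ε_pos
  have hCH := ((isStep_iff P N hτ s z).1 h).1
  have h1 := hCH.1 z.μ
  have h2 := hCH.2 (z.φ - s.φ)
  have hm : massForm S (z.φ - s.φ) z.μ = massForm S z.μ (z.φ - s.φ) := massForm_symm _ _
  rw [mobilityForm_apply, transport_apply, hm, ← h2, splitEnergyDeriv_apply,
    real_inner_self_eq_norm_sq, real_inner_self_eq_norm_sq] at h1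
  have h3 := h.stokes z.uc z.Pc
  have h4 := h.darcy z.um z.Pm
  rw [stokes_eq] at h3
  rw [darcy_eq] at h4
  have h3' : P.ρ₀ * ⟪velC S (z.uc - s.uc), velC S z.uc⟫ + τ * viscous P s.φ N z.uc z.uc
      + τ * ⟪traceM S z.Pm, normalC N S z.uc⟫ + τ * ⟪capC s.φ z.μ, velC S z.uc⟫ = 0 := by
    have e := mul_inv_cancel₀ hτ.ne'
    linear_combination τ * h3 - P.ρ₀ * ⟪velC S (z.uc - s.uc), velC S z.uc⟫ * e
  have h4' : P.ρ₀ / P.χ * ⟪z.um.1 - s.um.1, z.um.1⟫ + τ * ⟪drag P s.φ z.um, z.um.1⟫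
      + τ * ⟪capM s.φ z.μ, z.um.1⟫ - τ * ⟪traceM S z.Pm, normalC N S z.uc⟫ = 0 := by
    have e := mul_inv_cancel₀ hτ.ne'
    linear_combination τ * h4 - P.ρ₀ / P.χ * ⟪z.um.1 - s.um.1, z.um.1⟫ * e
  have k1 := kinetic_energy_le hρ τ (velC S z.uc) (velC S s.uc) (capC s.φ z.μ)
  -- In the matrix the effective density is ρ₀/χ, so τ²/ρ becomes τ · τχ/ρ₀, the weight of the
  -- matrix term in τ times the mobility form.
  have k2 := kinetic_energy_le (div_pos hρ hχ) τ z.um.1 s.um.1 (capM s.φ z.μ)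
  rw [← map_sub] at k1
  have w1 := mul_le_mul_of_nonneg_left (doubleWell_sub_le z.φ s.φ)
    (mul_pos hγ (one_div_pos.2 hε)).le
  have w2 : ⟪phaseGrad S z.φ, phaseGrad S (z.φ - s.φ)⟫ = ‖phaseGrad S z.φ‖ ^ 2 / 2
      - ‖phaseGrad S s.φ‖ ^ 2 / 2 + ‖phaseGrad S (z.φ - s.φ)‖ ^ 2 / 2 := by
    rw [map_sub, norm_sub_sq_real, inner_sub_right, real_inner_self_eq_norm_sq]
    ring
  have w3 := mul_nonneg hτ.le (mobGrad_nonneg P s.φ z.μ)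
  rw [w2] at h1
  have c1 : τ / (P.ρ₀ / P.χ) = τ * P.χ / P.ρ₀ := by field_simp
  have c2 : P.ρ₀ / P.χ / 2 = P.ρ₀ / (2 * P.χ) := by field_simp
  have c3 : P.ρ₀ / P.χ / 4 = P.ρ₀ / (4 * P.χ) := by field_simp
  rw [c1, c2, c3] at k2
  rw [energy_eq, energy_eq, ac_eq, am_eq]
  linarith

end Laws

end

end CHSD

theorem theorem1 {d : ℕ} (hd : d = 2 ∨ d = 3) (G : CHSD.KarstDomain d)
    (N : CHSD.InterfaceFrame G) (P : CHSD.Params G) (S : CHSD.FESpaces G)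
    (τ : ℝ) (hτ : 0 < τ) (s : CHSD.State S) :
    (∃! z : CHSD.Unknowns S, CHSD.IsStep N P τ s z) ∧
    ∀ z : CHSD.Unknowns S, CHSD.IsStep N P τ s z →
      (∫ x in G.Ω, z.φ.1 x) = (∫ x in G.Ω, s.φ.1 x) ∧
      CHSD.energy P z.toState - CHSD.energy P s
          + τ * CHSD.ac N P s.φ.1 z.uc.1 z.uc.1 + τ * CHSD.am P s.φ.1 z.um.1 z.um.1
        ≤ -(P.γ * P.ε / 2 * ∫ x in G.Ω, ‖∇ (z.φ.1 - s.φ.1) x‖ ^ 2)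
          - P.ρ₀ / 4 * (∫ x in G.Ωc, ‖z.uc.1 x - s.uc.1 x‖ ^ 2)
          - P.ρ₀ / (4 * P.χ) * (∫ x in G.Ωm, ‖z.um.1 x - s.um.1 x‖ ^ 2) ∧
      CHSD.energy P z.toState ≤ CHSD.energy P s := by
  have : NeZero d := ⟨by omega⟩
  refine ⟨CHSD.existsUnique_isStep P N hτ s, fun z hz => ?_⟩
  have hlaw := hz.energy_law P hτ
  have h1 := mul_nonneg hτ.le (CHSD.ac_nonneg P s.φ N z.uc)
  have h2 := mul_nonneg hτ.le (CHSD.am_nonneg P s.φ z.um)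
  have hρ := P.ρ₀_pos
  have hχ := P.χ_pos
  have hγ := P.γ_pos
  have hε := P.ε_pos
  refine ⟨hz.mass P hτ, by rw [CHSD.dissipation_eq]; exact hlaw, ?_⟩
  have h3 : 0 ≤ P.γ * P.ε / 2 * ‖CHSD.phaseGrad S (z.φ - s.φ)‖ ^ 2 := by positivity
  have h4 : 0 ≤ P.ρ₀ / 4 * ‖CHSD.velC S (z.uc - s.uc)‖ ^ 2 := by positivity
  have h5 : 0 ≤ P.ρ₀ / (4 * P.χ) * ‖z.um.1 - s.um.1‖ ^ 2 := by positivity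
  linarith
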